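/- For $N\ge 1$ and $b\in\mathbb N$, let $d_N(i,j)=\min(|i-j|,\,N-|i-j|)$ be the cyclic distance on $\{1,\dots,N\}$ and $l_N=\min(2b+1,N)$. The complex Gaussian band matrices with band parameter $b$ are the $N\times N$ matrices $G_1,G_2,\dots$ with entries $$(G_r)_{i,j}=\frac{1}{\sqrt{l_N}}\,\mathbf 1_{d_N(i,j)\le b}\,Z^{(r)}_{i,j},$$ where the $Z^{(r)}_{i,j}$ ($r\ge1$, $1\le i,j\le N$) are i.i.d. standard complex Gaussian variables. For $v\ge0$, $\mathscr N_{\mathbb C}(0,v)$ denotes the law of $X+iY$ with $X,Y$ independent real centred Gaussian variables of variance $v/2$ each; standard means $v=1$. Let $w=G_{i_1}G_{i_2}\cdots G_{i_m}$ be a word of length $m\ge1$ in the letters $G_1,G_2,\dots$ (a $*$-free word: no conjugate transposes occur), and let $\mathrm{cop}(w)$ be its coperiod, the largest integer $k$ such that $w=u^k$ for some word $u$. Let $(b_N)_{N\ge1}$ be non-negative integers with $b_N/N^{1/3}\to\infty$ and $b_N/N\to0$ as $N\to\infty$. For each $N$ let $G_w$ be the product $G_{i_1}\cdots G_{i_m}$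 of the corresponding $N\times N$ complex Gaussian band matrices with band parameter $b_N$, and let $l_N=\min(2b_N+1,N)$. Then $$\sqrt{\frac{l_N}{N}}\;\mathrm{Tr}\,G_w\;\xrightarrow[N\to\infty]{d}\;\mathscr N_{\mathbb C}\bigl(0,\mathrm{cop}(w)\,\alpha_m\bigr),\qquad \alpha_m=\frac1\pi\int_{-\infty}^{\infty}\mathrm{sinc}(\theta)^m\,d\theta\ \ge 0,$$ where $\mathrm{sinc}(\theta)=\sin(\theta)/\theta$ (and $\mathrm{sinc}(0)=1$), and the integral converges as an improper integral (for $m=1$ it does not converge absolutely). -/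

import Mathlib

open MeasureTheory ProbabilityTheory Filter Topology
open scoped NNReal

/-- The complex Gaussian law `𝒩_ℂ(0, v)`: the law of `X + iY` with `X`, `Y` independent real
centred Gaussian variables, each of variance `v / 2`. The standard one is `v = 1`. -/
noncomputable def complexGaussian (v : ℝ≥0) : Measure ℂ :=
  ((gaussianReal 0 (v / 2)).prod (gaussianReal 0 (v / 2))).map
    (fun p : ℝ × ℝ => (p.1 : ℂ) + (p.2 : ℂ) * Complex.I)

instance complexGaussian_isProbabilityMeasure (v : ℝ≥0) :
    IsProbabilityMeasure (complexGaussian v) :=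
  Measure.isProbabilityMeasure_map (by fun_prop)

/-- The cyclic distance `min (|i - j|, N - |i - j|)` between two indices. -/
def cyclicDist {N : ℕ} (i j : Fin N) : ℕ :=
  min ((i : ℤ) - (j : ℤ)).natAbs (N - ((i : ℤ) - (j : ℤ)).natAbs)

/-- `min (2 b + 1, N)`, the number of indices within cyclic distance `b` of a given one. -/
def bandLength (N b : ℕ) : ℕ := min (2 * b + 1) N

/-- The band matrix with band parameter `b` built from the array `Z`: its `(i, j)` entry is
`Z i j / √l` within cyclic distance `b` of the diagonal, and `0` elsewhere. -/
noncomputable def bandMatrix {N : ℕ} (b : ℕ) (Z : Fin N → Fin N → ℂ) :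
    Matrix (Fin N) (Fin N) ℂ :=
  Matrix.of fun i j =>
    if cyclicDist i j ≤ b then ((1 / √(bandLength N b : ℝ) : ℝ) : ℂ) * Z i j else 0

/-- The matrix `G_w = G_{i_1} ⋯ G_{i_m}` obtained from the word `w = i_1 ⋯ i_m`. -/
noncomputable def wordMatrix {N : ℕ} (G : ℕ → Matrix (Fin N) (Fin N) ℂ) (w : FreeMonoid ℕ) :
    Matrix (Fin N) (Fin N) ℂ :=
  FreeMonoid.lift G w

/-- The coperiod of a nonempty word `w`: the largest `k` such that `w = u ^ k` for a word `u`. -/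
noncomputable def coperiod (w : FreeMonoid ℕ) : ℕ :=
  sSup {k : ℕ | ∃ u : FreeMonoid ℕ, w = u ^ k}

/-- `J` is the (improper Riemann) integral of the locally integrable function `f` over the real
line: `∫ x in s..t, f x` tends to `J` as `s → -∞` and `t → ∞` independently. It agrees with the
Lebesgue integral when `f` is integrable. -/
def HasImproperIntegral (f : ℝ → ℝ) (J : ℝ) : Prop :=
  Tendsto (fun p : ℝ × ℝ => ∫ x in p.1..p.2, f x) (atBot ×ˢ atTop) (𝓝 J)

/-! Write `F` for the scaled trace. Expanding the trace over closed walks `x` of length `m` in the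
band graph gives `F = c ∑ₓ ∏ₖ Z (a k) (x k) (x (k+1))`, where `a` is the word read cyclically and
`c² = l / (N l ^ m)`. As no conjugate occurs, `F` is a holomorphic homogeneous polynomial of degree
`m` in independent standard complex Gaussians, and its limit law can be found by Stein's method
instead of by computing all moments.

Complex Gaussian integration by parts together with Euler's identity `m F = ∑ₑ zₑ ∂ₑF` turns the
derivative of `s ↦ E exp (i s Re F)` into `-(s / 2m) E [|∇F|² exp (i s Re F)]`. If `|∇F|² / m` were
the constant `v`, this would be the differential equation of the characteristic function of `𝒩_ℂ(0,
v)`; in general the error is at most half of `E | |∇F|² / m - v |` (`norm_integral_expRe_sub_le`).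
It remains to show that `|∇F|² / m` concentrates at `cop(w) α_m`.

Fluctuations: `|∇F|²` is a double sum over pairs of walks `x, y` sharing a removed edge. Two such
pairs have non-zero covariance only if their edges match and the walks `x, x'` meet. There are `O(N
l ^ (2m - 2))` meeting pairs, each with boundedly many completions, so the variance is `O(c⁴ N l ^
(2m - 2)) = O(1 / N)` (`gradSq_walkPoly_concentration`).

Mean: only pairs of walks with the same labelled edges contribute. If `x` is injective, its partners
are its cyclic shifts by the periods of `a`, and there are `cop(w)` of these
(`coperiod_eq_card_periods`). Non-injective walks cost a factor `1 / l`. Hence the mean of `|∇F|² /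
m` is `cop(w) c² #{closed walks} + O(1 / l)` (`abs_integral_gradSq_walkPoly_sub_le`).

Counting: for `m b < N` a closed walk cannot wind around the cycle, so `c² #{closed walks}` is the
number of `m`-tuples of steps in `{-b, …, b}` with sum `0`, divided by `l ^ (m - 1)`. By Fourier
inversion this is an integral of a power of the Dirichlet kernel, which converges to `(1 / π) ∫ sinc
^ m` (`exists_improperIntegral_sinc_pow`). -/

/-! ### The complex Gaussian law: characteristic function, rotation invariance, moments. -/

open Complex in
theorem charFun_complexGaussian (v : ℝ≥0) (t : ℂ) :
    charFun (complexGaussian v) t = cexp (-((v : ℝ) * ‖t‖ ^ 2 / 4 : ℝ)) := by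
  rw [charFun_apply, complexGaussian, integral_map (by fun_prop) (by fun_prop)]
  have h : ∀ p : ℝ × ℝ, cexp ((inner ℝ ((p.1 : ℂ) + (p.2 : ℂ) * I) t : ℝ) * I) =
      cexp (t.re * p.1 * I) * cexp (t.im * p.2 * I) := by
    intro p
    rw [← Complex.exp_add]
    congr 1
    simp [Complex.inner]
    ring
  simp_rw [h]
  rw [integral_prod_mul (fun x : ℝ => cexp (t.re * x * I)) (fun x : ℝ => cexp (t.im * x * I)),
    ← charFun_apply_real, ← charFun_apply_real, charFun_gaussianReal, charFun_gaussianReal,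
    ← Complex.exp_add]
  congr 1
  rw [Complex.sq_norm, Complex.normSq_apply]
  push_cast
  ring

theorem map_mul_complexGaussian (v : ℝ≥0) (u : ℂ) (hu : ‖u‖ = 1) :
    (complexGaussian v).map (fun z => u * z) = complexGaussian v := by
  have : IsProbabilityMeasure ((complexGaussian v).map (fun z => u * z)) :=
    Measure.isProbabilityMeasure_map (by fun_prop)
  refine Measure.ext_of_charFun (funext fun t => ?_)
  have : charFun ((complexGaussian v).map (fun z => u * z)) t =
      charFun (complexGaussian v) ((starRingEnd ℂ) u * t) := by
    rw [charFun_apply, charFun_apply, integral_map (by fun_prop) (by fun_prop)]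
    congr with z
    congr 2
    simp [Complex.inner]
    ring
  rw [this, charFun_complexGaussian, charFun_complexGaussian]
  simp [hu]

theorem integral_complexGaussian {v : ℝ≥0} {f : ℂ → ℂ}
    (hf : AEStronglyMeasurable f (complexGaussian v)) :
    ∫ z, f z ∂complexGaussian v = ∫ p : ℝ × ℝ, f ((p.1 : ℂ) + (p.2 : ℂ) * Complex.I)
      ∂((gaussianReal 0 (v / 2)).prod (gaussianReal 0 (v / 2))) := by
  rw [complexGaussian] at hf ⊢
  exact integral_map (by fun_prop) hf

theorem integrable_complexGaussian_iff {v : ℝ≥0} {f : ℂ → ℂ}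
    (hf : AEStronglyMeasurable f (complexGaussian v)) :
    Integrable f (complexGaussian v) ↔
      Integrable (fun p : ℝ × ℝ => f ((p.1 : ℂ) + (p.2 : ℂ) * Complex.I))
      ((gaussianReal 0 (v / 2)).prod (gaussianReal 0 (v / 2))) := by
  rw [complexGaussian] at hf ⊢
  exact integrable_map_measure hf (by fun_prop)

theorem memLp_id_complexGaussian (v : ℝ≥0) (p : ℝ≥0) : MemLp id p (complexGaussian v) := by
  rw [complexGaussian, memLp_map_measure_iff (by fun_prop) (by fun_prop)]
  have h1 : MemLp (fun p : ℝ × ℝ => p.1) p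
      ((gaussianReal 0 (v / 2)).prod (gaussianReal 0 (v / 2))) :=
    (memLp_id_gaussianReal p).comp_measurePreserving measurePreserving_fst
  have h2 : MemLp (fun p : ℝ × ℝ => p.2) p
      ((gaussianReal 0 (v / 2)).prod (gaussianReal 0 (v / 2))) :=
    (memLp_id_gaussianReal p).comp_measurePreserving measurePreserving_snd
  have h3 := (h1.norm.add h2.norm)
  refine h3.of_le (by fun_prop) (ae_of_all _ fun p => ?_)
  have := norm_add_le (p.1 : ℂ) ((p.2 : ℂ) * Complex.I)
  simp at this
  simp only [Function.comp, id, Pi.add_apply, Real.norm_eq_abs]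
  exact this.trans (le_abs_self _)

theorem integrable_norm_pow_complexGaussian (v : ℝ≥0) (n : ℕ) :
    Integrable (fun z : ℂ => ‖z‖ ^ n) (complexGaussian v) := by
  have := (memLp_id_complexGaussian v n)
  exact this.integrable_norm_pow' 

theorem integral_pow_mul_conj_pow_complexGaussian (v : ℝ≥0) {a b : ℕ} (hab : a ≠ b) :
    ∫ z, z ^ a * (starRingEnd ℂ) z ^ b ∂complexGaussian v = 0 := by
  -- The angle is chosen so that rotating by `u` multiplies `z ^ a * conj z ^ b` by `exp (iθ(a - b))
  -- = -1`. By rotation invariance the integral equals its own negative.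
  set θ : ℝ := Real.pi / ((a : ℝ) - b) with hθ
  set u : ℂ := Complex.exp (θ * Complex.I) with hu
  have hu1 : ‖u‖ = 1 := Complex.norm_exp_ofReal_mul_I θ
  have hc : u ^ a * (starRingEnd ℂ) u ^ b = -1 := by
    rw [hu, ← Complex.exp_conj, ← Complex.exp_nat_mul, ← Complex.exp_nat_mul, ← Complex.exp_add,
      ← Complex.exp_pi_mul_I]
    congr 1
    have : ((a : ℂ) - b) ≠ 0 := by
      rw [sub_ne_zero]; exact_mod_cast hab
    simp [hθ]
    field_simp
    ring
  have h : ∫ z, z ^ a * (starRingEnd ℂ) z ^ b ∂complexGaussian v =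
      ∫ z, (u * z) ^ a * (starRingEnd ℂ) (u * z) ^ b ∂complexGaussian v := by
    conv_lhs => rw [← map_mul_complexGaussian v u hu1]
    rw [integral_map (by fun_prop) (by fun_prop)]
  have h' : ∀ z : ℂ, (u * z) ^ a * (starRingEnd ℂ) (u * z) ^ b =
      -1 * (z ^ a * (starRingEnd ℂ) z ^ b) := by
    intro z
    rw [← hc, map_mul]
    ring
  simp_rw [h'] at h
  rw [integral_const_mul] at h
  linear_combination h / 2

theorem integral_norm_sq_complexGaussian_one :
    ∫ z, ‖z‖ ^ 2 ∂complexGaussian 1 = 1 := by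
  rw [complexGaussian, integral_map (by fun_prop) (by fun_prop)]
  have h : ∀ p : ℝ × ℝ, ‖(p.1 : ℂ) + (p.2 : ℂ) * Complex.I‖ ^ 2 = p.1 ^ 2 + p.2 ^ 2 := by
    intro p
    rw [Complex.sq_norm, Complex.normSq_apply]
    simp
    ring
  simp_rw [h]
  have hi : Integrable (fun x : ℝ => x ^ 2) (gaussianReal 0 (1 / 2)) :=
    (memLp_id_gaussianReal 2).integrable_sq
  have hv : ∫ x, x ^ 2 ∂gaussianReal 0 (1 / 2) = 1 / 2 := by
    have := variance_fun_id_gaussianReal (μ := 0) (v := 1 / 2)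
    rw [variance_eq_integral (by fun_prop)] at this
    simpa using this
  rw [integral_add (hi.comp_fst _) (hi.comp_snd _), integral_fun_fst (fun x : ℝ => x ^ 2),
    integral_fun_snd (fun x : ℝ => x ^ 2), hv]
  norm_num

/-! ### Gaussian integration by parts in one variable. -/

/-- The density `ρ` satisfies `ρ' = -(x / v) ρ`, so this is integration by parts against `ρ`. -/
theorem integral_id_mul_gaussianReal {v : ℝ≥0} (hv : v ≠ 0) {g g' : ℝ → ℂ}
    (hg : ∀ x, HasDerivAt g (g' x) x)
    (h0 : Integrable g (gaussianReal 0 v)) (h1 : Integrable g' (gaussianReal 0 v))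
    (h2 : Integrable (fun x : ℝ => (x : ℂ) * g x) (gaussianReal 0 v)) :
    ∫ x : ℝ, (x : ℂ) * g x ∂gaussianReal 0 v = v * ∫ x, g' x ∂gaussianReal 0 v := by
  have key : ∀ f : ℝ → ℂ, Integrable f (gaussianReal 0 v) →
      Integrable (fun x : ℝ => ((gaussianPDFReal 0 v x : ℝ) : ℂ) * f x) := by
    intro f hf
    rw [gaussianReal_of_var_ne_zero _ hv, integrable_withDensity_iff_integrable_smul'
      (measurable_gaussianPDF 0 v) (ae_of_all _ fun _ => gaussianPDF_lt_top)] at hf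
    simpa [toReal_gaussianPDF, Complex.real_smul] using hf
  have hpdf : ∀ x : ℝ, HasDerivAt (fun x : ℝ => ((gaussianPDFReal 0 v x : ℝ) : ℂ))
      (-(x : ℂ) / v * (gaussianPDFReal 0 v x : ℝ)) x := by
    intro x
    have : HasDerivAt (gaussianPDFReal 0 v) (-x / v * gaussianPDFReal 0 v x) x := by
      simp only [gaussianPDFReal_def]
      have h0 : HasDerivAt (fun x : ℝ => -(x - 0) ^ 2 / (2 * (v : ℝ)))
          (-(2 * (x - 0)) / (2 * (v : ℝ))) x := by
        simpa using (((hasDerivAt_id x).sub_const 0).pow 2).neg.div_const (2 * (v : ℝ))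
      have h := h0.exp.const_mul (√(2 * Real.pi * v))⁻¹
      have hv' : (v : ℝ) ≠ 0 := by exact_mod_cast hv
      refine h.congr_deriv ?_
      rw [sub_zero, mul_left_comm]
      field_simp
    simpa using this.ofReal_comp
  rw [integral_gaussianReal_eq_integral_smul hv, integral_gaussianReal_eq_integral_smul hv]
  have := integral_mul_deriv_eq_deriv_mul_of_integrable
    (u := fun x => ((gaussianPDFReal 0 v x : ℝ) : ℂ)) (v := g) (fun x _ => hpdf x)
    (fun x _ => hg x) (key _ h1)
    (by
      have := (key _ h2).const_mul (-1 / (v : ℂ))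
      refine this.congr (ae_of_all _ fun x => ?_)
      simp only [Pi.mul_apply]
      ring) (key _ h0)
  simp_rw [Complex.real_smul]
  rw [this, ← integral_neg, ← integral_const_mul]
  congr with x
  have : (v : ℂ) ≠ 0 := by exact_mod_cast hv
  field_simp

/-- Gaussian integration by parts in the plane, for a function with partial derivatives `gx`
and `gy`. -/
theorem integral_id_mul_complexGaussian {g gx gy : ℂ → ℂ}
    (hgx : ∀ x y : ℝ, HasDerivAt (fun s : ℝ => g (s + y * Complex.I)) (gx (x + y * Complex.I)) x)
    (hgy : ∀ x y : ℝ, HasDerivAt (fun s : ℝ => g (x + s * Complex.I)) (gy (x + y * Complex.I)) y)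
    (h0 : Integrable g (complexGaussian 1)) (h1 : Integrable gx (complexGaussian 1))
    (h2 : Integrable gy (complexGaussian 1)) (h3 : Integrable (fun z => z * g z) (complexGaussian 1)) :
    ∫ z, z * g z ∂complexGaussian 1 =
      (1 / 2) * ∫ z, (gx z + Complex.I * gy z) ∂complexGaussian 1 := by
  have hre : Integrable (fun z : ℂ => (z.re : ℂ) * g z) (complexGaussian 1) := by
    refine h3.mono (by have := h0.1; fun_prop) (ae_of_all _ fun z => ?_)
    simp only [norm_mul, Complex.norm_real]
    gcongr
    exact Complex.abs_re_le_norm z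
  have him : Integrable (fun z : ℂ => (z.im : ℂ) * g z) (complexGaussian 1) := by
    refine h3.mono (by have := h0.1; fun_prop) (ae_of_all _ fun z => ?_)
    simp only [norm_mul, Complex.norm_real]
    gcongr
    exact Complex.abs_im_le_norm z
  have hv : (1 / 2 : ℝ≥0) ≠ 0 := by norm_num
  have e1 : ∫ z, (z.re : ℂ) * g z ∂complexGaussian 1 = (1 / 2) * ∫ z, gx z ∂complexGaussian 1 := by
    have a0 := (integrable_complexGaussian_iff h0.1).1 h0
    have a1 := (integrable_complexGaussian_iff h1.1).1 h1
    have a2 := (integrable_complexGaussian_iff hre.1).1 hre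
    rw [integral_complexGaussian hre.1, integral_complexGaussian h1.1, integral_prod_symm _ a2,
      integral_prod_symm _ a1, ← integral_const_mul]
    refine integral_congr_ae ?_
    filter_upwards [a0.prod_left_ae, a1.prod_left_ae, a2.prod_left_ae] with y b0 b1 b2
    simp only [Complex.add_re, Complex.ofReal_re, Complex.mul_re, Complex.I_re, mul_zero,
      Complex.ofReal_im, Complex.I_im, sub_self, add_zero, mul_one] at b2 ⊢
    rw [integral_id_mul_gaussianReal hv (fun x => hgx x y) b0 b1 b2]
    simp
  have e2 : ∫ z, (z.im : ℂ) * g z ∂complexGaussian 1 = (1 / 2) * ∫ z, gy z ∂complexGaussian 1 := by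
    have a0 := (integrable_complexGaussian_iff h0.1).1 h0
    have a1 := (integrable_complexGaussian_iff h2.1).1 h2
    have a2 := (integrable_complexGaussian_iff him.1).1 him
    rw [integral_complexGaussian him.1, integral_complexGaussian h2.1, integral_prod _ a2,
      integral_prod _ a1, ← integral_const_mul]
    refine integral_congr_ae ?_
    filter_upwards [a0.prod_right_ae, a1.prod_right_ae, a2.prod_right_ae] with y b0 b1 b2
    simp only [Complex.add_im, Complex.ofReal_im, Complex.mul_im, Complex.I_im, mul_one,
      Complex.ofReal_re, Complex.I_re, mul_zero, add_zero, zero_add] at b2 ⊢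
    rw [integral_id_mul_gaussianReal hv (fun x => hgy y x) b0 b1 b2]
    simp
  have : ∀ z : ℂ, z * g z = (z.re : ℂ) * g z + Complex.I * ((z.im : ℂ) * g z) := by
    intro z
    linear_combination g z * (Complex.re_add_im z).symm
  simp_rw [this]
  rw [integral_add hre (him.const_mul _), integral_const_mul, e1, e2,
    integral_add h1 (h2.const_mul _), integral_const_mul]
  ring

/-- The oscillating factor `exp (i Re z)`. -/
noncomputable def expRe (z : ℂ) : ℂ := Complex.exp ((z.re : ℂ) * Complex.I)

theorem norm_expRe (z : ℂ) : ‖expRe z‖ = 1 := Complex.norm_exp_ofReal_mul_I _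

@[fun_prop]
theorem continuous_expRe : Continuous expRe := by unfold expRe; fun_prop

theorem integrable_mul_expRe {α : Type*} [MeasurableSpace α] {μ : Measure α} {f q : α → ℂ}
    (hf : Integrable f μ) (hq : AEStronglyMeasurable q μ) :
    Integrable (fun x => f x * expRe (q x)) μ :=
  hf.mul_bdd (c := 1) (continuous_expRe.comp_aestronglyMeasurable hq)
    (ae_of_all _ fun _ => (norm_expRe _).le)

theorem hasDerivAt_expRe_comp {q : ℝ → ℂ} {q' : ℂ} {x : ℝ} (hq : HasDerivAt q q' x) :
    HasDerivAt (fun s => expRe (q s)) (expRe (q x) * (((q'.re : ℝ) : ℂ) * Complex.I)) x := by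
  unfold expRe
  have h1 : HasDerivAt (fun s => (q s).re) q'.re x :=
    (Complex.reCLM.hasFDerivAt.comp_hasDerivAt x hq)
  have h2 := (h1.ofReal_comp.mul_const Complex.I).cexp
  exact h2

/-- Integration by parts replaces the factor `z` by the operator `∂/∂z̄ = (∂ₓ + i ∂ᵧ) / 2`. It kills
the holomorphic factor `p`, and on `exp (i Re q)`, with `Re q = (q + q̄) / 2`, it produces the
factor `(i / 2) conj q'`. -/
theorem integral_id_mul_mul_expRe {p q p' q' : ℂ → ℂ}
    (hp : ∀ z, HasDerivAt p (p' z) z) (hq : ∀ z, HasDerivAt q (q' z) z)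
    (hq' : Continuous q')
    (h0 : Integrable p (complexGaussian 1)) (h1 : Integrable p' (complexGaussian 1))
    (h2 : Integrable (fun z => p z * q' z) (complexGaussian 1))
    (h3 : Integrable (fun z => z * p z) (complexGaussian 1)) :
    ∫ z, z * p z * expRe (q z) ∂complexGaussian 1 =
      (Complex.I / 2) * ∫ z, p z * (starRingEnd ℂ) (q' z) * expRe (q z) ∂complexGaussian 1 := by
  have hqc : Continuous q := continuous_iff_continuousAt.2 fun z => (hq z).continuousAt
  have hqm : AEStronglyMeasurable q (complexGaussian 1) := hqc.aestronglyMeasurable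
  -- One computation along a line with direction `c` serves both partial derivatives: `c = 1` and `c
  -- = I`.
  have hline : ∀ (c w : ℂ) (x : ℝ), HasDerivAt (fun s : ℝ => w + (s : ℂ) * c) c x := by
    intro c w x
    simpa using ((Complex.ofRealCLM.hasDerivAt (x := x)).mul_const c).const_add w
  have hcomp : ∀ (c w : ℂ) (x : ℝ),
      HasDerivAt (fun s : ℝ => p (w + (s : ℂ) * c) * expRe (q (w + (s : ℂ) * c)))
        ((p' (w + x * c) * c + p (w + x * c) * ((((q' (w + x * c) * c).re : ℝ) : ℂ) * Complex.I)) *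
          expRe (q (w + x * c))) x := by
    intro c w x
    have a1 := (hp (w + x * c)).comp x (hline c w x)
    have a2 := hasDerivAt_expRe_comp ((hq (w + x * c)).comp x (hline c w x))
    refine (a1.mul a2).congr_deriv ?_
    simp only [Function.comp]
    ring
  have hint : ∀ c : ℂ, Integrable (fun z => (p' z * c + p z * ((((q' z * c).re : ℝ) : ℂ) * Complex.I)) *
          expRe (q z)) (complexGaussian 1) := by
    intro c
    refine integrable_mul_expRe ((h1.mul_const c).add ?_) hqm
    refine (h2.mul_const c).mono ?_ (ae_of_all _ fun z => ?_)
    · have := h0.1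
      fun_prop
    · simp only [norm_mul, Complex.norm_real, Complex.norm_I, mul_one, mul_assoc]
      gcongr
      rw [← norm_mul]
      exact Complex.abs_re_le_norm _
  have key := integral_id_mul_complexGaussian (g := fun z => p z * expRe (q z))
    (gx := fun z => (p' z * 1 + p z * ((((q' z * 1).re : ℝ) : ℂ) * Complex.I)) * expRe (q z))
    (gy := fun z => (p' z * Complex.I + p z * ((((q' z * Complex.I).re : ℝ) : ℂ) * Complex.I)) *
      expRe (q z))
    (fun x y => by
      have := hcomp 1 (y * Complex.I) x
      simpa only [mul_one, add_comm] using this)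
    (fun x y => hcomp Complex.I x y)
    (integrable_mul_expRe h0 hqm) (hint 1) (hint Complex.I)
    (by simpa only [mul_assoc] using integrable_mul_expRe h3 hqm)
  simp_rw [mul_assoc] at key ⊢
  rw [key, ← integral_const_mul, ← integral_const_mul]
  congr with z
  have : (starRingEnd ℂ) (q' z) = ((q' z).re : ℂ) - (q' z).im * Complex.I := by
    apply Complex.ext <;> simp
  rw [this]
  simp only [mul_one, Complex.mul_re, Complex.I_re, Complex.I_im, mul_zero, zero_sub]
  push_cast
  linear_combination (1 / 2) * (p' z * expRe (q z)) * Complex.I_mul_I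

/-! ### Stein's method for homogeneous polynomials in independent complex Gaussians. -/

/-- The law of a family of independent standard complex Gaussian variables. -/
noncomputable abbrev gaussianFamily (E : Type*) [Fintype E] : Measure (E → ℂ) :=
  Measure.pi fun _ => complexGaussian 1

/-- Resampling one coordinate independently preserves the product law. This lets a one-variable
identity be applied to a single coordinate, by Fubini, without splitting the product space. -/
theorem measurePreserving_update {ι : Type*} [Fintype ι] [DecidableEq ι] {X : Type*}
    [MeasurableSpace X] (μ : Measure X) [IsProbabilityMeasure μ] (i : ι) :
    MeasurePreserving (fun p : (ι → X) × X => Function.update p.1 i p.2)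
      ((Measure.pi fun _ : ι => μ).prod μ) (Measure.pi fun _ : ι => μ) := by
  have hm : Measurable (fun p : (ι → X) × X => Function.update p.1 i p.2) := by
    refine measurable_pi_lambda _ fun j => ?_
    by_cases h : j = i
    · subst h; simpa using measurable_snd
    · simp only [Function.update_of_ne h]
      fun_prop
  refine ⟨hm, (Measure.pi_eq fun s hs => ?_).symm⟩
  rw [Measure.map_apply hm (MeasurableSet.univ_pi hs)]
  have : (fun p : (ι → X) × X => Function.update p.1 i p.2) ⁻¹' Set.pi Set.univ s =
      (Set.pi Set.univ (Function.update s i Set.univ)) ×ˢ s i := by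
    ext ⟨p, a⟩
    simp only [Set.mem_preimage, Set.mem_pi, Set.mem_univ, true_imp_iff, Set.mem_prod]
    constructor
    · intro h
      refine ⟨fun j => ?_, by simpa using h i⟩
      by_cases hj : j = i
      · subst hj; simp
      · simpa [Function.update_of_ne hj] using h j
    · rintro ⟨h1, h2⟩ j
      by_cases hj : j = i
      · subst hj; simpa using h2
      · simpa [Function.update_of_ne hj] using h1 j
  rw [this, Measure.prod_prod, Measure.pi_pi]
  rw [← Finset.mul_prod_erase Finset.univ _ (Finset.mem_univ i),
    ← Finset.mul_prod_erase Finset.univ (fun j => μ (s j)) (Finset.mem_univ i)]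
  simp only [Function.update_self, measure_univ, one_mul]
  rw [mul_comm]
  congr 1
  refine Finset.prod_congr rfl fun j hj => ?_
  rw [Function.update_of_ne (Finset.ne_of_mem_erase hj)]

@[fun_prop]
theorem continuous_eval_mvPolynomial {E : Type*} (F : MvPolynomial E ℂ) :
    Continuous fun z : E → ℂ => MvPolynomial.eval z F := MvPolynomial.continuous_eval F

theorem hasDerivAt_eval_update {E : Type*} [DecidableEq E] (F : MvPolynomial E ℂ) (z : E → ℂ) (e : E) (a : ℂ) :
    HasDerivAt (fun a => MvPolynomial.eval (Function.update z e a) F)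
      (MvPolynomial.eval (Function.update z e a) (MvPolynomial.pderiv e F)) a := by
  induction F using MvPolynomial.induction_on with
  | C c => simpa using hasDerivAt_const a c
  | add p q hp hq =>
    simp only [map_add]
    exact hp.add hq
  | mul_X p i hp =>
    have hX : HasDerivAt (fun a => Function.update z e a i) (if i = e then 1 else 0) a := by
      by_cases h : i = e
      · subst h; simpa using hasDerivAt_id' a
      · simpa [Function.update_of_ne h, h] using hasDerivAt_const a (z i)
    have := hp.mul hX
    simp only [map_mul, MvPolynomial.eval_X, Derivation.leibniz, MvPolynomial.pderiv_X, map_add,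
      smul_eq_mul]
    refine this.congr_deriv ?_
    by_cases h : i = e
    · subst h; simp; ring
    · simp [h]; ring

section

variable {E : Type*} [Fintype E]

theorem memLp_eval_gaussianFamily (F : MvPolynomial E ℂ) :
    MemLp (fun z : E → ℂ => MvPolynomial.eval z F) 2 (gaussianFamily E) := by
  simp_rw [MvPolynomial.eval_eq']
  refine memLp_finsetSum _ fun d _ => MemLp.const_mul ?_ _
  have hc : Continuous fun z : E → ℂ => ∏ i, z i ^ d i := by fun_prop
  rw [memLp_two_iff_integrable_sq_norm hc.aestronglyMeasurable]
  have : ∀ z : E → ℂ, ‖∏ i, z i ^ d i‖ ^ 2 = ∏ i, ‖z i‖ ^ (d i * 2) := by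
    intro z
    rw [norm_prod, ← Finset.prod_pow]
    simp [pow_mul]
  simp_rw [this]
  exact Integrable.fintype_prod (f := fun i (z : ℂ) => ‖z‖ ^ (d i * 2))
    fun i => integrable_norm_pow_complexGaussian 1 _

theorem integrable_eval_gaussianFamily (F : MvPolynomial E ℂ) :
    Integrable (fun z : E → ℂ => MvPolynomial.eval z F) (gaussianFamily E) :=
  (memLp_eval_gaussianFamily F).integrable (by norm_num)

theorem integrable_eval_mul_conj_eval (F G : MvPolynomial E ℂ) :
    Integrable (fun z : E → ℂ => MvPolynomial.eval z F * (starRingEnd ℂ) (MvPolynomial.eval z G))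
      (gaussianFamily E) :=
  (memLp_eval_gaussianFamily F).integrable_mul (memLp_eval_gaussianFamily G).star

theorem integral_X_mul_mul_expRe [DecidableEq E] (e : E) (F Q : MvPolynomial E ℂ) :
    ∫ z, z e * MvPolynomial.eval z F * expRe (MvPolynomial.eval z Q) ∂gaussianFamily E =
      (Complex.I / 2) * ∫ z, MvPolynomial.eval z F *
        (starRingEnd ℂ) (MvPolynomial.eval z (MvPolynomial.pderiv e Q)) *
        expRe (MvPolynomial.eval z Q) ∂gaussianFamily E := by
  have hU : MeasurePreserving (fun p : (E → ℂ) × ℂ => Function.update p.1 e p.2)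
      ((gaussianFamily E).prod (complexGaussian 1)) (gaussianFamily E) :=
    measurePreserving_update (complexGaussian 1) e
  have hint : ∀ G : MvPolynomial E ℂ, ∀ᵐ z ∂gaussianFamily E,
      Integrable (fun a => MvPolynomial.eval (Function.update z e a) G) (complexGaussian 1) := by
    intro G
    exact (hU.integrable_comp_of_integrable (integrable_eval_gaussianFamily G)).prod_right_ae
  have i1 : Integrable (fun z : E → ℂ => z e * MvPolynomial.eval z F *
      expRe (MvPolynomial.eval z Q)) (gaussianFamily E) := by
    refine integrable_mul_expRe ?_ (by fun_prop)
    exact (integrable_eval_gaussianFamily (MvPolynomial.X e * F)).congr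
      (ae_of_all _ fun z => by simp)
  have i2 : Integrable (fun z : E → ℂ => MvPolynomial.eval z F *
        (starRingEnd ℂ) (MvPolynomial.eval z (MvPolynomial.pderiv e Q)) *
        expRe (MvPolynomial.eval z Q)) (gaussianFamily E) :=
    integrable_mul_expRe (integrable_eval_mul_conj_eval _ _) (by fun_prop)
  have tr : ∀ f : (E → ℂ) → ℂ, Integrable f (gaussianFamily E) →
      ∫ z, f z ∂gaussianFamily E =
        ∫ z, ∫ a, f (Function.update z e a) ∂complexGaussian 1 ∂gaussianFamily E := by
    intro f hf
    have h1 := integral_prod _ (hU.integrable_comp_of_integrable hf)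
    simp only [Function.comp] at h1
    rw [← h1]
    conv_lhs => rw [← hU.map_eq]
    rw [integral_map hU.measurable.aemeasurable (by rw [hU.map_eq]; exact hf.1)]
  rw [tr _ i1, tr _ i2, ← integral_const_mul]
  refine integral_congr_ae ?_
  filter_upwards [hint F, hint (MvPolynomial.pderiv e F), hint (F * MvPolynomial.pderiv e Q),
    hint (MvPolynomial.X e * F)] with z h0 h1 h2 h3
  simp only [map_mul, MvPolynomial.eval_X, Function.update_self] at h2 h3 ⊢
  exact integral_id_mul_mul_expRe (fun a => hasDerivAt_eval_update F z e a)
    (fun a => hasDerivAt_eval_update Q z e a) (by fun_prop) h0 h1 h2 h3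

/-- The squared norm of the holomorphic gradient of `F`. -/
noncomputable def gradSq (F : MvPolynomial E ℂ) (z : E → ℂ) : ℝ :=
  ∑ e, ‖MvPolynomial.eval z (MvPolynomial.pderiv e F)‖ ^ 2

theorem integrable_gradSq (F : MvPolynomial E ℂ) : Integrable (gradSq F) (gaussianFamily E) := by
  unfold gradSq
  refine integrable_finsetSum _ fun e _ => ?_
  exact (memLp_two_iff_integrable_sq_norm (by fun_prop)).1 (memLp_eval_gaussianFamily _)

theorem continuous_gradSq (F : MvPolynomial E ℂ) : Continuous (gradSq F) := by
  unfold gradSq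
  fun_prop

/-- Euler's identity writes `F` as `(1 / m) ∑ₑ zₑ ∂ₑF`; integrating by parts in each `zₑ` pairs
`∂ₑF` with its own conjugate, and the squared gradient appears. -/
theorem integral_mul_expRe_self {F : MvPolynomial E ℂ} {m : ℕ} (hm : m ≠ 0)
    (hF : F.IsHomogeneous m) (s : ℝ) :
    ∫ z, MvPolynomial.eval z F * expRe (s * MvPolynomial.eval z F) ∂gaussianFamily E =
      (Complex.I * s / (2 * m)) *
        ∫ z, (gradSq F z : ℂ) * expRe (s * MvPolynomial.eval z F) ∂gaussianFamily E := by
  classical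
  have hE : ∀ z : E → ℂ, MvPolynomial.eval z F = (1 / (m : ℂ)) *
      ∑ e, z e * MvPolynomial.eval z (MvPolynomial.pderiv e F) := by
    intro z
    have := congrArg (MvPolynomial.eval z) hF.sum_X_mul_pderiv
    simp only [map_sum, map_mul, MvPolynomial.eval_X, nsmul_eq_mul, map_natCast] at this
    rw [this]
    field_simp
  have hQ : ∀ z : E → ℂ, (s : ℂ) * MvPolynomial.eval z F =
      MvPolynomial.eval z (MvPolynomial.C (s : ℂ) * F) := by simp
  have h1 : ∀ z : E → ℂ, MvPolynomial.eval z F * expRe (s * MvPolynomial.eval z F) =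
      (1 / (m : ℂ)) * ∑ e, z e * MvPolynomial.eval z (MvPolynomial.pderiv e F) *
        expRe (MvPolynomial.eval z (MvPolynomial.C (s : ℂ) * F)) := by
    intro z
    rw [hQ, ← Finset.sum_mul, ← mul_assoc, ← hE]
  have h2 : ∀ z : E → ℂ, (gradSq F z : ℂ) * expRe (s * MvPolynomial.eval z F) =
      ∑ e, MvPolynomial.eval z (MvPolynomial.pderiv e F) *
        (starRingEnd ℂ) (MvPolynomial.eval z (MvPolynomial.pderiv e F)) *
        expRe (MvPolynomial.eval z (MvPolynomial.C (s : ℂ) * F)) := by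
    intro z
    rw [hQ, ← Finset.sum_mul]
    congr 1
    simp [gradSq, Complex.mul_conj, Complex.normSq_eq_norm_sq]
  have hpd : ∀ (z : E → ℂ) (e : E), MvPolynomial.eval z
      (MvPolynomial.pderiv e (MvPolynomial.C (s : ℂ) * F)) =
        s * MvPolynomial.eval z (MvPolynomial.pderiv e F) := by
    intro z e
    rw [MvPolynomial.pderiv_C_mul, map_mul, MvPolynomial.eval_C]
  simp_rw [h1, h2]
  rw [integral_const_mul, integral_finsetSum, integral_finsetSum, Finset.mul_sum, Finset.mul_sum]
  · refine Finset.sum_congr rfl fun e _ => ?_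
    rw [integral_X_mul_mul_expRe]
    simp only [hpd, map_mul, Complex.conj_ofReal]
    rw [← integral_const_mul, ← integral_const_mul, ← integral_const_mul]
    congr with z
    ring
  · exact fun e _ => integrable_mul_expRe (integrable_eval_mul_conj_eval _ _) (by fun_prop)
  · intro e _
    refine integrable_mul_expRe ?_ (by fun_prop)
    exact (integrable_eval_gaussianFamily (MvPolynomial.X e * MvPolynomial.pderiv e F)).congr
      (ae_of_all _ fun z => by simp)

theorem conj_expRe (z : ℂ) : (starRingEnd ℂ) (expRe z) = expRe (-z) := by
  simp [expRe, ← Complex.exp_conj]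

/-- Conjugating the identity for `F` at `-s` gives the same right-hand side for `conj F` at `s`; the
two are averaged. -/
theorem integral_re_mul_expRe_self {F : MvPolynomial E ℂ} {m : ℕ} (hm : m ≠ 0)
    (hF : F.IsHomogeneous m) (s : ℝ) :
    ∫ z, ((MvPolynomial.eval z F).re : ℂ) * expRe (s * MvPolynomial.eval z F) ∂gaussianFamily E =
      (Complex.I * s / (2 * m)) *
        ∫ z, (gradSq F z : ℂ) * expRe (s * MvPolynomial.eval z F) ∂gaussianFamily E := by
  have h1 := integral_mul_expRe_self hm hF s
  have h2 := congrArg (starRingEnd ℂ) (integral_mul_expRe_self hm hF (-s))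
  rw [← integral_conj, map_mul, ← integral_conj] at h2
  simp only [map_mul, conj_expRe, Complex.conj_ofReal, Complex.ofReal_neg, neg_mul, neg_neg,
    map_div₀, map_neg, Complex.conj_I, mul_neg, map_natCast, Complex.conj_ofNat] at h2
  have h3 : ∀ z : E → ℂ, ((MvPolynomial.eval z F).re : ℂ) * expRe (s * MvPolynomial.eval z F) =
      (1 / 2) * (MvPolynomial.eval z F * expRe (s * MvPolynomial.eval z F)) +
      (1 / 2) * ((starRingEnd ℂ) (MvPolynomial.eval z F) * expRe (s * MvPolynomial.eval z F)) := by
    intro z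
    rw [Complex.re_eq_add_conj]
    ring
  simp_rw [h3]
  have hi := integrable_eval_gaussianFamily F
  have hi2 : Integrable (fun z : E → ℂ => (starRingEnd ℂ) (MvPolynomial.eval z F))
      (gaussianFamily E) := by
    simpa using integrable_eval_mul_conj_eval 1 F
  rw [integral_add ((integrable_mul_expRe hi (by fun_prop)).const_mul _)
    ((integrable_mul_expRe hi2 (by fun_prop)).const_mul _), integral_const_mul,
    integral_const_mul, h1, h2]
  ring

/-- **Stein's bound**: a homogeneous polynomial in independent complex Gaussian variables is
close to a complex Gaussian variable when its squared gradient is close to a constant. -/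
theorem norm_integral_expRe_sub_le {F : MvPolynomial E ℂ} {m : ℕ} (hm : m ≠ 0)
    (hF : F.IsHomogeneous m) {v : ℝ} (hv : 0 ≤ v) :
    ‖∫ z, expRe (MvPolynomial.eval z F) ∂gaussianFamily E - Complex.exp (-(v / 4 : ℝ))‖ ≤
      (1 / 2) * ∫ z, |gradSq F z / m - v| ∂gaussianFamily E := by
  set φ : ℝ → ℂ := fun s => ∫ z, expRe (s * MvPolynomial.eval z F) ∂gaussianFamily E with hφ
  set ε := ∫ z, |gradSq F z / m - v| ∂gaussianFamily E with hε
  have hi := integrable_eval_gaussianFamily F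
  have hgi := integrable_gradSq F
  have hgc := continuous_gradSq F
  have hd : ∀ s : ℝ, HasDerivAt φ (∫ z, expRe (s * MvPolynomial.eval z F) *
      (((MvPolynomial.eval z F).re : ℂ) * Complex.I) ∂gaussianFamily E) s := by
    intro s
    refine (hasDerivAt_integral_of_dominated_loc_of_deriv_le (s := Set.univ) (𝕜 := ℝ)
      (F := fun (s : ℝ) z => expRe (s * MvPolynomial.eval z F))
      (F' := fun (s : ℝ) z => expRe (s * MvPolynomial.eval z F) *
      (((MvPolynomial.eval z F).re : ℂ) * Complex.I))
      (bound := fun z => ‖MvPolynomial.eval z F‖) univ_mem ?_ ?_ ?_ ?_ hi.norm ?_).2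
    · exact Eventually.of_forall fun s => by fun_prop
    · simpa using integrable_mul_expRe (integrable_const (1 : ℂ)) (q := fun z : E → ℂ =>
        (s : ℂ) * MvPolynomial.eval z F) (by fun_prop)
    · fun_prop
    · refine ae_of_all _ fun z s _ => ?_
      simp only [norm_mul, norm_expRe, Complex.norm_real, Complex.norm_I, one_mul, mul_one]
      exact Complex.abs_re_le_norm _
    · refine ae_of_all _ fun z s _ => ?_
      have h := hasDerivAt_expRe_comp
        ((Complex.ofRealCLM.hasDerivAt (x := s)).mul_const (MvPolynomial.eval z F))
      simpa using h
  -- The Gaussian differential equation `φ' = -(s v / 2) φ`, perturbed by the deviation of `|∇F|² /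
  -- m` from `v`.
  have hd' : ∀ s : ℝ, HasDerivAt φ (-(s / 2) * (v * φ s + ∫ z, ((gradSq F z / m - v : ℝ) : ℂ) *
      expRe (s * MvPolynomial.eval z F) ∂gaussianFamily E)) s := by
    intro s
    refine (hd s).congr_deriv ?_
    have e1 : ∀ z : E → ℂ, expRe (s * MvPolynomial.eval z F) *
        (((MvPolynomial.eval z F).re : ℂ) * Complex.I) =
        Complex.I * (((MvPolynomial.eval z F).re : ℂ) * expRe (s * MvPolynomial.eval z F)) := by
      intro z; ring
    have e2 : ∀ z : E → ℂ, ((gradSq F z / m - v : ℝ) : ℂ) * expRe (s * MvPolynomial.eval z F) =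
        (1 / (m : ℂ)) * ((gradSq F z : ℂ) * expRe (s * MvPolynomial.eval z F)) -
        v * ((1 : ℂ) * expRe (s * MvPolynomial.eval z F)) := by
      intro z
      push_cast
      ring
    simp_rw [e1, e2]
    rw [integral_const_mul, integral_re_mul_expRe_self hm hF, integral_sub, integral_const_mul,
      integral_const_mul]
    · simp only [one_mul]
      linear_combination (s / (2 * m) * ∫ z, (gradSq F z : ℂ) *
        expRe (s * MvPolynomial.eval z F) ∂gaussianFamily E) * Complex.I_mul_I
    · exact (integrable_mul_expRe hgi.ofReal (by fun_prop)).const_mul _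
    · exact (integrable_mul_expRe (integrable_const (1 : ℂ)) (by fun_prop)).const_mul _
  -- The integrating factor removes the main term, so only the perturbation is left in `h'`. The
  -- mean value inequality on `[0, 1]` then bounds `h 1 - h 0`, and the factor `exp (v / 4)` cancels
  -- at the end.
  set h : ℝ → ℂ := fun s => Complex.exp ((v * s ^ 2 / 4 : ℝ)) * φ s with hh
  have hexp : ∀ s : ℝ, HasDerivAt (fun s : ℝ => Complex.exp ((v * s ^ 2 / 4 : ℝ)))
      (Complex.exp ((v * s ^ 2 / 4 : ℝ)) * (v * s / 2 : ℝ)) s := by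
    intro s
    have : HasDerivAt (fun s : ℝ => v * s ^ 2 / 4) (v * s / 2) s := by
      have := (((hasDerivAt_id s).pow 2).const_mul v).div_const 4
      refine this.congr_deriv ?_
      simp
      ring
    exact this.ofReal_comp.cexp
  have hhd : ∀ s : ℝ, HasDerivAt h (Complex.exp ((v * s ^ 2 / 4 : ℝ)) * (-(s / 2) *
      ∫ z, ((gradSq F z / m - v : ℝ) : ℂ) *
      expRe (s * MvPolynomial.eval z F) ∂gaussianFamily E)) s := by
    intro s
    refine ((hexp s).mul (hd' s)).congr_deriv ?_
    push_cast
    ring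
  have hbd : ∀ s ∈ Set.Ico (0 : ℝ) 1, ‖Complex.exp ((v * s ^ 2 / 4 : ℝ)) * (-(s / 2) *
      ∫ z, ((gradSq F z / m - v : ℝ) : ℂ) *
      expRe (s * MvPolynomial.eval z F) ∂gaussianFamily E)‖ ≤ Real.exp (v / 4) * ((1 / 2) * ε) := by
    intro s hs
    rw [norm_mul, Complex.norm_exp_ofReal, norm_mul]
    have hε0 : 0 ≤ ε := integral_nonneg fun _ => abs_nonneg _
    gcongr
    · have : s ^ 2 ≤ 1 := by nlinarith [hs.1, hs.2]
      nlinarith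
    · rw [norm_neg, norm_div, Complex.norm_real, Complex.norm_ofNat, Real.norm_of_nonneg hs.1]
      linarith [hs.2]
    · refine (norm_integral_le_integral_norm _).trans (le_of_eq ?_)
      simp [norm_expRe, hε]
      simp_rw [← Complex.ofReal_natCast, ← Complex.ofReal_div, ← Complex.ofReal_sub,
        Complex.norm_real, Real.norm_eq_abs]
  have hmv := norm_image_sub_le_of_norm_deriv_le_segment_01'
    (fun s _ => (hhd s).hasDerivWithinAt) hbd
  have h1 : h 1 = Complex.exp ((v / 4 : ℝ)) *
      ∫ z, expRe (MvPolynomial.eval z F) ∂gaussianFamily E := by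
    simp [hh, hφ]
  have h0 : h 0 = 1 := by
    simp [hh, hφ, expRe]
  rw [h1, h0] at hmv
  have : Complex.exp ((v / 4 : ℝ)) * ∫ z, expRe (MvPolynomial.eval z F) ∂gaussianFamily E - 1 =
      Complex.exp ((v / 4 : ℝ)) * (∫ z, expRe (MvPolynomial.eval z F) ∂gaussianFamily E -
        Complex.exp (-(v / 4 : ℝ))) := by
    rw [mul_sub, ← Complex.exp_add, add_neg_cancel, Complex.exp_zero]
  rw [this, norm_mul, Complex.norm_exp_ofReal] at hmv
  exact le_of_mul_le_mul_left hmv (Real.exp_pos _)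

end

/-! ### Mixed moments of Gaussian monomials, and second moments of sums of them. -/

/-- The absolute moment `E |z|^(2a)` of the standard complex Gaussian law. -/
noncomputable def normSqMoment (a : ℕ) : ℝ := ∫ z, ‖z‖ ^ (2 * a) ∂complexGaussian 1

theorem normSqMoment_zero : normSqMoment 0 = 1 := by simp [normSqMoment]

theorem normSqMoment_one : normSqMoment 1 = 1 := integral_norm_sq_complexGaussian_one

theorem normSqMoment_nonneg (a : ℕ) : 0 ≤ normSqMoment a :=
  integral_nonneg fun _ => by positivity

theorem integral_pow_mul_conj_pow (a b : ℕ) :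
    ∫ z, z ^ a * (starRingEnd ℂ) z ^ b ∂complexGaussian 1 =
      if a = b then (normSqMoment a : ℂ) else 0 := by
  split_ifs with h
  · subst h
    rw [normSqMoment, ← integral_complex_ofReal]
    congr with z
    rw [← mul_pow, Complex.mul_conj, Complex.normSq_eq_norm_sq]
    push_cast
    rw [pow_mul]
  · exact integral_pow_mul_conj_pow_complexGaussian 1 h

/-- An upper bound for the absolute moments of order at most `2 D`. -/
noncomputable def momentBound (D : ℕ) : ℝ := 1 + ∑ a ∈ Finset.range (D + 1), normSqMoment a

theorem one_le_momentBound (D : ℕ) : 1 ≤ momentBound D :=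
  le_add_of_nonneg_right (Finset.sum_nonneg fun a _ => normSqMoment_nonneg a)

/-- The exponent `a` makes the product of these bounds over all variables a power of `momentBound D`
with exponent the degree, whatever the number of variables. -/
theorem normSqMoment_le_pow {a D : ℕ} (h : a ≤ D) : normSqMoment a ≤ momentBound D ^ a := by
  rcases Nat.eq_zero_or_pos a with rfl | ha
  · simp [normSqMoment_zero]
  · calc normSqMoment a ≤ momentBound D := by
          have := Finset.single_le_sum (f := normSqMoment) (fun a _ => normSqMoment_nonneg a)
            (Finset.mem_range.2 (Nat.lt_succ_of_le h))
          unfold momentBound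
          linarith
      _ ≤ momentBound D ^ a := le_self_pow₀ (one_le_momentBound D) ha.ne'

section

variable {E : Type*} [Fintype E]

/-- The second absolute moment `E |Z^α|^2` of a monomial. -/
noncomputable def wick (α : E →₀ ℕ) : ℝ := ∏ e, normSqMoment (α e)

theorem wick_nonneg (α : E →₀ ℕ) : 0 ≤ wick α :=
  Finset.prod_nonneg fun _ _ => normSqMoment_nonneg _

theorem wick_le (α : E →₀ ℕ) {D : ℕ} (h : ∑ e, α e ≤ D) : wick α ≤ momentBound D ^ D := by
  calc wick α ≤ ∏ e, momentBound D ^ α e := by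
        refine Finset.prod_le_prod (fun _ _ => normSqMoment_nonneg _) fun e _ => ?_
        exact normSqMoment_le_pow
          ((Finset.single_le_sum (fun _ _ => Nat.zero_le _) (Finset.mem_univ e)).trans h)
    _ = momentBound D ^ ∑ e, α e := Finset.prod_pow_eq_pow_sum _ _ _
    _ ≤ momentBound D ^ D := pow_le_pow_right₀ (one_le_momentBound D) h

theorem wick_eq_one {α : E →₀ ℕ} (h : ∀ e, α e ≤ 1) : wick α = 1 := by
  refine Finset.prod_eq_one fun e _ => ?_
  have := h e
  interval_cases α e
  · exact normSqMoment_zero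
  · exact normSqMoment_one

theorem wick_add_of_disjoint {α β : E →₀ ℕ} (h : ∀ e, α e = 0 ∨ β e = 0) :
    wick (α + β) = wick α * wick β := by
  unfold wick
  rw [← Finset.prod_mul_distrib]
  refine Finset.prod_congr rfl fun e _ => ?_
  rcases h e with h | h <;> simp [h, normSqMoment_zero]

open Classical in
/-- The mixed moment `E [Z^α conj (Z^β)]`. -/
noncomputable def mixedMoment (α β : E →₀ ℕ) : ℝ := if α = β then wick α else 0

theorem mixedMoment_nonneg (α β : E →₀ ℕ) : 0 ≤ mixedMoment α β := by
  unfold mixedMoment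
  split_ifs
  · exact wick_nonneg α
  · exact le_rfl

theorem mixedMoment_le (α β : E →₀ ℕ) {D : ℕ} (h : ∑ e, α e ≤ D) :
    mixedMoment α β ≤ momentBound D ^ D := by
  unfold mixedMoment
  split_ifs
  · exact wick_le α h
  · have := one_le_momentBound D
    positivity

/-- The value at `z` of the monomial `Z^α`. -/
noncomputable def mono (α : E →₀ ℕ) (z : E → ℂ) : ℂ := ∏ e, z e ^ α e

theorem eval_monomial_eq_mono (α : E →₀ ℕ) (c : ℂ) (z : E → ℂ) :
    MvPolynomial.eval z (MvPolynomial.monomial α c) = c * mono α z := by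
  rw [MvPolynomial.eval_monomial, Finsupp.prod_fintype _ _ (by simp), mono]

theorem mono_add (α β : E →₀ ℕ) (z : E → ℂ) : mono (α + β) z = mono α z * mono β z := by
  simp [mono, pow_add, Finset.prod_mul_distrib]

@[fun_prop]
theorem continuous_mono (α : E →₀ ℕ) : Continuous (mono α) := by
  unfold mono
  fun_prop

theorem integral_mono_mul_conj_mono (α β : E →₀ ℕ) :
    ∫ z, mono α z * (starRingEnd ℂ) (mono β z) ∂gaussianFamily E = mixedMoment α β := by
  have h : ∀ z : E → ℂ, mono α z * (starRingEnd ℂ) (mono β z) =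
      ∏ e, (z e ^ α e * (starRingEnd ℂ) (z e) ^ β e) := by
    intro z
    simp [mono, Finset.prod_mul_distrib]
  simp_rw [h]
  rw [integral_fintype_prod_eq_prod (fun e z => z ^ α e * (starRingEnd ℂ) z ^ β e)]
  simp_rw [integral_pow_mul_conj_pow]
  unfold mixedMoment
  split_ifs with hab
  · subst hab
    simp [wick]
  · obtain ⟨e, he⟩ := DFunLike.ne_iff.1 hab
    rw [Finset.prod_eq_zero (Finset.mem_univ e) (if_neg he)]
    simp

theorem memLp_mono_mul_conj_mono (α β : E →₀ ℕ) :
    MemLp (fun z : E → ℂ => mono α z * (starRingEnd ℂ) (mono β z)) 2 (gaussianFamily E) := by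
  refine (memLp_eval_gaussianFamily (MvPolynomial.monomial (α + β) 1)).congr_norm (by fun_prop)
    (ae_of_all _ fun z => ?_)
  simp [eval_monomial_eq_mono, mono_add]

section SecondMoment

variable {ι : Type*} {T : Finset ι} {a : ι → ℝ} {α β : ι → E →₀ ℕ} {G : (E → ℂ) → ℝ}

theorem integral_sum_mono
    (hG : ∀ z, (G z : ℂ) = ∑ τ ∈ T, a τ * (mono (α τ) z * (starRingEnd ℂ) (mono (β τ) z))) :
    ∫ z, G z ∂gaussianFamily E = ∑ τ ∈ T, a τ * mixedMoment (α τ) (β τ) := by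
  have : ((∫ z, G z ∂gaussianFamily E : ℝ) : ℂ) =
      ∑ τ ∈ T, (a τ : ℂ) * (mixedMoment (α τ) (β τ) : ℂ) := by
    rw [← integral_complex_ofReal]
    simp_rw [hG]
    rw [integral_finsetSum _ fun τ _ =>
      ((memLp_mono_mul_conj_mono (α τ) (β τ)).integrable (by norm_num)).const_mul _]
    refine Finset.sum_congr rfl fun τ _ => ?_
    rw [integral_const_mul, integral_mono_mul_conj_mono]
  exact_mod_cast this

theorem memLp_sum_mono
    (hG : ∀ z, (G z : ℂ) = ∑ τ ∈ T, a τ * (mono (α τ) z * (starRingEnd ℂ) (mono (β τ) z))) :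
    MemLp G 2 (gaussianFamily E) := by
  have h : MemLp (fun z => (G z : ℂ)) 2 (gaussianFamily E) := by
    simp_rw [hG]
    exact memLp_finsetSum _ fun τ _ => (memLp_mono_mul_conj_mono (α τ) (β τ)).const_mul _
  exact h.re

theorem integral_sum_mono_sq
    (hG : ∀ z, (G z : ℂ) = ∑ τ ∈ T, a τ * (mono (α τ) z * (starRingEnd ℂ) (mono (β τ) z))) :
    ∫ z, G z ^ 2 ∂gaussianFamily E =
    ∑ τ ∈ T, ∑ τ' ∈ T, a τ * a τ' * mixedMoment (α τ + α τ') (β τ + β τ') := by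
  have h2 : ∀ z, ((G z ^ 2 : ℝ) : ℂ) = ∑ p ∈ T ×ˢ T, ((a p.1 * a p.2 : ℝ) : ℂ) *
      (mono (α p.1 + α p.2) z * (starRingEnd ℂ) (mono (β p.1 + β p.2) z)) := by
    intro z
    push_cast
    rw [sq, hG, Finset.sum_mul_sum, Finset.sum_product]
    refine Finset.sum_congr rfl fun τ _ => Finset.sum_congr rfl fun τ' _ => ?_
    rw [mono_add, mono_add, map_mul]
    ring
  have := integral_sum_mono (G := fun z => G z ^ 2) (T := T ×ˢ T) (a := fun p => a p.1 * a p.2)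
    (α := fun p => α p.1 + α p.2) (β := fun p => β p.1 + β p.2) h2
  rw [this, Finset.sum_product]

/-- Cauchy–Schwarz bounds the squared first absolute deviation by the variance, which is then
expanded as a double sum of covariances. -/
theorem integral_sum_mono_sub_sq
    (hG : ∀ z, (G z : ℂ) = ∑ τ ∈ T, a τ * (mono (α τ) z * (starRingEnd ℂ) (mono (β τ) z))) :
    (∫ z, |G z - ∫ w, G w ∂gaussianFamily E| ∂gaussianFamily E) ^ 2 ≤
      ∑ τ ∈ T, ∑ τ' ∈ T, a τ * a τ' * (mixedMoment (α τ + α τ') (β τ + β τ') -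
        mixedMoment (α τ) (β τ) * mixedMoment (α τ') (β τ')) := by
  set μ := ∫ w, G w ∂gaussianFamily E with hμ
  have hL := memLp_sum_mono hG
  have hL2 : MemLp (fun z => |G z - μ|) 2 (gaussianFamily E) := (hL.sub (memLp_const μ)).abs
  have hv := variance_eq_sub hL2
  have hnn := variance_nonneg (fun z => |G z - μ|) (gaussianFamily E)
  rw [hv] at hnn
  have hV : Var[G; gaussianFamily E] = ∫ z, |G z - μ| ^ 2 ∂gaussianFamily E := by
    rw [variance_eq_integral hL.1.aemeasurable]
    simp [hμ]
  have hV2 := variance_eq_sub hL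
  simp only [Pi.pow_apply] at hnn hV2
  refine (sub_nonneg.1 hnn).trans (le_of_eq ?_)
  rw [← hV, hV2, integral_sum_mono_sq hG, integral_sum_mono hG, sq, Finset.sum_mul_sum,
    ← Finset.sum_sub_distrib]
  refine Finset.sum_congr rfl fun τ _ => ?_
  rw [← Finset.sum_sub_distrib]
  refine Finset.sum_congr rfl fun τ' _ => ?_
  ring

end SecondMoment

end

/-! ### Counting closed walks in a graph of bounded out-degree. -/

section Walks

variable {m : ℕ} [NeZero m] {V : Type*} [Fintype V]

theorem ZMod.eq_univ_of_add_one_mem {S : Finset (ZMod m)} {j : ZMod m} (hj : j ∈ S)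
    (h : ∀ i ∈ S, i + 1 ∈ S) : S = Finset.univ := by
  have key : ∀ n : ℕ, j + n ∈ S := by
    intro n
    induction n with
    | zero => simpa using hj
    | succ n ih => simpa [add_assoc] using h _ ih
  refine Finset.eq_univ_of_forall fun i => ?_
  simpa using key (i - j).val

open Classical in
/-- The closed walks of length `m` along the relation `A`, with a marked starting point. -/
noncomputable def closedWalks (m : ℕ) [NeZero m] (A : V → V → Prop) : Finset (ZMod m → V) :=
  {x | ∀ k, A (x k) (x (k + 1))}

theorem mem_closedWalks {A : V → V → Prop} {x : ZMod m → V} :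
    x ∈ closedWalks m A ↔ ∀ k, A (x k) (x (k + 1)) := by
  simp [closedWalks]

-- The positions in `S` are chosen along the walk, each among at most `l` successors of the previous
-- vertex. The condition `S ≠ univ` supplies a fixed position from which every run of free positions
-- starts.
open Classical in
theorem card_walks_fixed_off_le {A : V → V → Prop} {l : ℕ}
    (hl : ∀ u, (Finset.univ.filter fun v => A u v).card ≤ l) (x₀ : ZMod m → V) :
    ∀ (n : ℕ) (S : Finset (ZMod m)), S ≠ Finset.univ → S.card = n →
      (Finset.univ.filter fun x : ZMod m → V =>
        (∀ i ∉ S, x i = x₀ i) ∧ ∀ i ∈ S, A (x (i - 1)) (x i)).card ≤ l ^ n := by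
  intro n
  induction n with
  | zero =>
    intro S _ hS
    rw [Finset.card_eq_zero] at hS
    subst hS
    rw [pow_zero, Finset.card_le_one]
    intro x hx y hy
    simp only [Finset.notMem_empty, not_false_eq_true, forall_const, Finset.mem_filter,
      Finset.mem_univ, true_and] at hx hy
    funext i
    rw [hx.1, hy.1]
  | succ n ih =>
    intro S hS hc
    -- Such an `i` ends a run of free positions: no constraint at another free position involves `x
    -- i`, so `i` can be removed from `S`.
    obtain ⟨i, hi, hi1⟩ : ∃ i ∈ S, i + 1 ∉ S := by
      by_contra! h
      obtain ⟨j, hj⟩ : S.Nonempty := by rw [← Finset.card_pos]; omega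
      exact hS (ZMod.eq_univ_of_add_one_mem hj h)
    have hne : i - 1 ≠ i := by
      intro h
      apply hi1
      have : i + 1 = i := by
        nth_rewrite 1 [← h]
        ring
      rwa [this]
    have hS' : S.erase i ≠ Finset.univ := fun h => by
      have := Finset.mem_univ i
      rw [← h] at this
      exact Finset.notMem_erase i S this
    rw [pow_succ, mul_comm]
    refine (Finset.card_le_mul_card_image_of_maps_to
      (f := fun x : ZMod m → V => Function.update x i (x₀ i)) ?_ l ?_).trans
      (Nat.mul_le_mul_left l (ih (S.erase i) hS' (by rw [Finset.card_erase_of_mem hi, hc]; rfl)))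
    · intro x hx
      simp only [Finset.mem_filter, Finset.mem_univ, true_and] at hx ⊢
      refine ⟨fun j hj => ?_, fun j hj => ?_⟩
      · by_cases h : j = i
        · subst h; simp
        · rw [Function.update_of_ne h]
          exact hx.1 j fun h' => hj (Finset.mem_erase.2 ⟨h, h'⟩)
      · have hji := Finset.ne_of_mem_erase hj
        have hj1 : j - 1 ≠ i := by
          rintro rfl
          exact hi1 (by simpa using Finset.mem_of_mem_erase hj)
        rw [Function.update_of_ne hji, Function.update_of_ne hj1]
        exact hx.2 j (Finset.mem_of_mem_erase hj)
    · intro y _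
      refine le_trans ?_ (hl (y (i - 1)))
      refine le_trans (Finset.card_le_card ?_)
        (Finset.card_image_le (f := fun v => Function.update y i v))
      intro x hx
      simp only [Finset.mem_filter, Finset.mem_univ, true_and, Finset.mem_image] at hx ⊢
      refine ⟨x i, ?_, ?_⟩
      · rw [← hx.2, Function.update_of_ne hne]
        exact hx.1.2 i hi
      · rw [← hx.2]
        simp

open Classical in
theorem card_closedWalks_through_le {A : V → V → Prop} {l : ℕ}
    (hl : ∀ u, (Finset.univ.filter fun v => A u v).card ≤ l) (j : ZMod m) (v : V) :
    ((closedWalks m A).filter fun x => x j = v).card ≤ l ^ (m - 1) := by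
  have h := card_walks_fixed_off_le hl (fun _ => v) (m - 1) (Finset.univ.erase j)
    (fun h => by
      have := Finset.mem_univ j
      rw [← h] at this
      exact Finset.notMem_erase j _ this)
    (by rw [Finset.card_erase_of_mem (Finset.mem_univ j), Finset.card_univ, ZMod.card])
  refine (Finset.card_le_card fun x hx => ?_).trans h
  simp only [Finset.mem_filter, Finset.mem_univ, true_and, mem_closedWalks] at hx ⊢
  refine ⟨fun i hi => ?_, fun i _ => by simpa using hx.1 (i - 1)⟩
  have : i = j := by simpa using hi
  rw [this, hx.2]

-- Forcing `x j = x k = v` fixes two positions at once: `v` is chosen freely and only `m - 2`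
-- positions remain.
open Classical in
theorem card_closedWalks_collision_le {A : V → V → Prop} {l : ℕ}
    (hl : ∀ u, (Finset.univ.filter fun v => A u v).card ≤ l) {j k : ZMod m} (hjk : j ≠ k) :
    ((closedWalks m A).filter fun x => x j = x k).card ≤ Fintype.card V * l ^ (m - 2) := by
  have hc : (Finset.univ \ {j, k} : Finset (ZMod m)).card = m - 2 := by
    rw [Finset.card_sdiff_of_subset (Finset.subset_univ _), Finset.card_univ, ZMod.card,
      Finset.card_pair hjk]
  have hS : (Finset.univ \ {j, k} : Finset (ZMod m)) ≠ Finset.univ := fun h => by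
    have := Finset.mem_univ j
    rw [← h] at this
    simp at this
  refine (Finset.card_le_card (t := Finset.univ.biUnion fun v =>
    (Finset.univ.filter fun x : ZMod m → V =>
        (∀ i ∉ (Finset.univ \ {j, k} : Finset (ZMod m)), x i = v) ∧
          ∀ i ∈ (Finset.univ \ {j, k} : Finset (ZMod m)), A (x (i - 1)) (x i))) ?_).trans ?_
  · intro x hx
    simp only [Finset.mem_filter, mem_closedWalks] at hx
    simp only [Finset.mem_biUnion, Finset.mem_filter, Finset.mem_univ, true_and]
    refine ⟨x j, fun i hi => ?_, fun i _ => by simpa using hx.1 (i - 1)⟩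
    have : i = j ∨ i = k := by simpa [or_iff_not_imp_left] using hi
    rcases this with rfl | rfl
    · rfl
    · exact hx.2.symm
  · refine Finset.card_biUnion_le.trans ((Finset.sum_le_card_nsmul _ _ _ fun v _ =>
      card_walks_fixed_off_le hl (fun _ => v) _ _ hS hc).trans ?_)
    simp

open Classical in
theorem card_closedWalks_not_injective_le {A : V → V → Prop} {l : ℕ}
    (hl : ∀ u, (Finset.univ.filter fun v => A u v).card ≤ l) :
    ((closedWalks m A).filter fun x => ¬ Function.Injective x).card ≤
      (m * m - m) * (Fintype.card V * l ^ (m - 2)) := by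
  refine (Finset.card_le_card (t := (Finset.univ : Finset (ZMod m)).offDiag.biUnion fun p => (closedWalks m A).filter fun x => x p.1 = x p.2) ?_).trans ?_
  · intro x hx
    simp only [Finset.mem_filter, Function.Injective, not_forall] at hx
    obtain ⟨hx, j, k, h, hjk⟩ := hx
    simp only [Finset.mem_biUnion, Finset.mem_offDiag, Finset.mem_filter, Finset.mem_univ, true_and, Prod.exists]
    exact ⟨j, k, hjk, hx, h⟩
  · refine Finset.card_biUnion_le.trans ((Finset.sum_le_card_nsmul _ _ _ fun p hp =>
      card_closedWalks_collision_le hl (Finset.mem_offDiag.1 hp).2.2).trans ?_)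
    rw [smul_eq_mul, Finset.offDiag_card, Finset.card_univ, ZMod.card]

-- A common vertex and its two positions are chosen first; each walk then passes through a
-- prescribed vertex and has `m - 1` free positions.
open Classical in
theorem card_closedWalks_meeting_le {A : V → V → Prop} {l : ℕ}
    (hl : ∀ u, (Finset.univ.filter fun v => A u v).card ≤ l) :
    ((closedWalks m A ×ˢ closedWalks m A).filter fun p => ∃ j k, p.1 j = p.2 k).card ≤
      m ^ 2 * (Fintype.card V * (l ^ (m - 1) * l ^ (m - 1))) := by
  refine (Finset.card_le_card (t := (Finset.univ : Finset ((ZMod m × ZMod m) × V)).biUnion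
    fun q => ((closedWalks m A).filter fun x => x q.1.1 = q.2) ×ˢ
      ((closedWalks m A).filter fun x => x q.1.2 = q.2)) ?_).trans ?_
  · rintro ⟨x, y⟩ hp
    simp only [Finset.mem_filter, Finset.mem_product] at hp
    obtain ⟨⟨hx, hy⟩, j, k, h⟩ := hp
    simp only [Finset.mem_biUnion, Finset.mem_filter, Finset.mem_univ, true_and,
      Finset.mem_product]
    exact ⟨((j, k), x j), ⟨hx, rfl⟩, hy, h.symm⟩
  · refine Finset.card_biUnion_le.trans ((Finset.sum_le_card_nsmul _ _
      (l ^ (m - 1) * l ^ (m - 1)) fun q _ => ?_).trans ?_)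
    · rw [Finset.card_product]
      exact Nat.mul_le_mul (card_closedWalks_through_le hl _ _) (card_closedWalks_through_le hl _ _)
    · simp [ZMod.card, sq, mul_assoc]

end Walks

/-! ### Which closed walks share their labelled edges. -/

section LabelledEdges

variable {m : ℕ} [NeZero m] {V L : Type*}

/-- The `k`-th labelled edge of the closed walk `x`. -/
def walkEdge (a : ZMod m → L) (x : ZMod m → V) (k : ZMod m) : L × V × V := (a k, x k, x (k + 1))

/-- The multiplicities of the labelled edges of the closed walk `x`. -/
noncomputable def edgeCount (a : ZMod m → L) (x : ZMod m → V) : L × V × V →₀ ℕ :=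
  ∑ k, Finsupp.single (walkEdge a x k) 1

theorem edgeCount_apply [DecidableEq (L × V × V)] (a : ZMod m → L) (x : ZMod m → V)
    (e : L × V × V) :
    edgeCount a x e = (Finset.univ.filter fun k => walkEdge a x k = e).card := by
  rw [Finset.card_filter]
  simp only [edgeCount, Finsupp.finsetSum_apply, Finsupp.single_apply]

theorem edgeCount_ne_zero_iff {a : ZMod m → L} {x : ZMod m → V} {e : L × V × V} :
    edgeCount a x e ≠ 0 ↔ ∃ k, walkEdge a x k = e := by
  classical
  rw [edgeCount_apply, Finset.card_ne_zero]
  simp [Finset.Nonempty]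

theorem edgeCount_le (a : ZMod m → L) (x : ZMod m → V) (e : L × V × V) :
    edgeCount a x e ≤ m := by
  classical
  rw [edgeCount_apply]
  refine (Finset.card_le_univ _).trans ?_
  simp [ZMod.card]

theorem sum_edgeCount [Fintype L] [Fintype V] (a : ZMod m → L) (x : ZMod m → V) :
    ∑ e, edgeCount a x e = m := by
  classical
  simp only [edgeCount, Finsupp.finsetSum_apply]
  rw [Finset.sum_comm]
  simp [Finsupp.single_apply, ZMod.card]

theorem edgeCount_le_one {a : ZMod m → L} {x : ZMod m → V} (hx : Function.Injective x)
    (e : L × V × V) : edgeCount a x e ≤ 1 := by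
  classical
  rw [edgeCount_apply, Finset.card_le_one]
  intro j hj k hk
  simp only [Finset.mem_filter, Finset.mem_univ, true_and] at hj hk
  have := hj.trans hk.symm
  simp only [walkEdge, Prod.mk.injEq] at this
  exact hx this.2.1

theorem edgeCount_shift {a : ZMod m → L} {k : ZMod m} (hk : ∀ j, a (j + k) = a j)
    (x : ZMod m → V) : edgeCount a (fun j => x (j + k)) = edgeCount a x := by
  unfold edgeCount
  refine Fintype.sum_equiv (Equiv.addRight k) _ _ fun j => ?_
  simp [walkEdge, hk, add_right_comm]

/-- On an injective walk `x` a vertex determines its position, hence the edge that leaves it. So `y`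
must follow `x` from wherever it enters, and comparing labels shows that the offset is a period of
`a`. -/
theorem eq_shift_of_edgeCount_eq {a : ZMod m → L} {x y : ZMod m → V} (hx : Function.Injective x)
    (h : ∀ e, edgeCount a y e ≠ 0 → edgeCount a x e ≠ 0) :
    ∃ k, (∀ j, a (j + k) = a j) ∧ y = fun j => x (j + k) := by
  have h' : ∀ j, ∃ i, walkEdge a x i = walkEdge a y j := fun j =>
    edgeCount_ne_zero_iff.1 (h _ (edgeCount_ne_zero_iff.2 ⟨j, rfl⟩))
  obtain ⟨k, hk⟩ := h' 0
  simp only [walkEdge, Prod.mk.injEq] at hk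
  have key : ∀ n : ℕ, y n = x (n + k) := by
    intro n
    induction n with
    | zero => simpa using hk.2.1.symm
    | succ n ih =>
      obtain ⟨i, hi⟩ := h' n
      simp only [walkEdge, Prod.mk.injEq] at hi
      have := hx (hi.2.1.trans ih)
      rw [this] at hi
      push_cast
      rw [← hi.2.2, add_right_comm]
  have key' : ∀ j, y j = x (j + k) := fun j => by simpa using key j.val
  refine ⟨k, fun j => ?_, funext key'⟩
  obtain ⟨i, hi⟩ := h' j
  simp only [walkEdge, Prod.mk.injEq] at hi
  have := hx (hi.2.1.trans (key' j))
  rw [← this, hi.1]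

open Classical in
theorem card_edgeCount_eq [Fintype V] {a : ZMod m → L} {x : ZMod m → V}
    (hx : Function.Injective x) {A : V → V → Prop} (hA : x ∈ closedWalks m A) :
    ((closedWalks m A).filter fun y => edgeCount a y = edgeCount a x).card =
      (Finset.univ.filter fun k : ZMod m => ∀ j, a (j + k) = a j).card := by
  symm
  refine Finset.card_bij (fun k _ => fun j => x (j + k)) ?_ ?_ ?_
  · intro k hk
    simp only [Finset.mem_filter, Finset.mem_univ, true_and, mem_closedWalks] at hk hA ⊢
    exact ⟨fun j => by simpa [add_right_comm] using hA (j + k), edgeCount_shift hk x⟩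
  · intro k _ k' _ h
    simpa using hx (congrFun h 0)
  · intro y hy
    rw [Finset.mem_filter] at hy
    obtain ⟨k, hk, hky⟩ := eq_shift_of_edgeCount_eq hx (a := a) (y := y) (by simp [hy.2])
    exact ⟨k, by simpa using hk, hky.symm⟩

/-- A closed walk that starts on `x` and only uses edges of `x` and of a walk `x'` with no vertex
in common with `x` stays on `x`. -/
theorem edgeCount_eq_of_disjoint [Fintype L] [Fintype V] {a : ZMod m → L} {x x' y y' : ZMod m → V}
    (hd : ∀ j k, x j ≠ x' k) {e : L × V × V} (hxe : edgeCount a x e ≠ 0)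
    (hye : edgeCount a y e ≠ 0) (h : edgeCount a x + edgeCount a x' = edgeCount a y + edgeCount a y') :
    edgeCount a x = edgeCount a y := by
  have hsub : ∀ e, edgeCount a y e ≠ 0 → edgeCount a x e ≠ 0 ∨ edgeCount a x' e ≠ 0 := by
    intro e he
    have := DFunLike.congr_fun h e
    simp only [Finsupp.add_apply] at this
    omega
  obtain ⟨i, hi⟩ := edgeCount_ne_zero_iff.1 hxe
  obtain ⟨k, hk⟩ := edgeCount_ne_zero_iff.1 hye
  have key : ∀ n : ℕ, ∃ j, y (k + n) = x j := by
    intro n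
    induction n with
    | zero =>
      refine ⟨i, ?_⟩
      have := hk.trans hi.symm
      simp only [walkEdge, Prod.mk.injEq] at this
      simpa using this.2.1
    | succ n ih =>
      obtain ⟨j, hj⟩ := ih
      rcases hsub _ (edgeCount_ne_zero_iff.2 ⟨k + n, rfl⟩) with h1 | h1
      · obtain ⟨j', hj'⟩ := edgeCount_ne_zero_iff.1 h1
        simp only [walkEdge, Prod.mk.injEq] at hj'
        refine ⟨j' + 1, ?_⟩
        rw [hj'.2.2]
        push_cast
        rw [add_assoc]
      · obtain ⟨j', hj'⟩ := edgeCount_ne_zero_iff.1 h1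
        simp only [walkEdge, Prod.mk.injEq] at hj'
        exact absurd (hj.symm.trans hj'.2.1.symm) (hd j j')
  have key' : ∀ i, ∃ j, y i = x j := fun i => by simpa using key (i - k).val
  have hle : ∀ e, edgeCount a y e ≤ edgeCount a x e := by
    intro e
    by_cases he : edgeCount a y e = 0
    · omega
    · have h0 : edgeCount a x' e = 0 := by
        by_contra h1
        obtain ⟨i, rfl⟩ := edgeCount_ne_zero_iff.1 he
        obtain ⟨j', hj'⟩ := edgeCount_ne_zero_iff.1 h1
        obtain ⟨j, hj⟩ := key' i
        simp only [walkEdge, Prod.mk.injEq] at hj'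
        exact hd j j' (hj.symm.trans hj'.2.1.symm)
      have := DFunLike.congr_fun h e
      simp only [Finsupp.add_apply] at this
      omega
  ext e
  -- Both walks have exactly `m` edges, so the pointwise inequality between multiplicities is an
  -- equality.
  have hs : ∑ e, edgeCount a y e = ∑ e, edgeCount a x e := by
    rw [sum_edgeCount, sum_edgeCount]
  exact ((Finset.sum_eq_sum_iff_of_le fun e _ => hle e).1 hs e (Finset.mem_univ e)).symm

end LabelledEdges

/-! ### The coperiod as the number of cyclic periods of the word. -/

section Coperiod

theorem FreeMonoid.length_pow {α : Type*} (u : FreeMonoid α) (k : ℕ) :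
    (u ^ k).length = k * u.length := by
  induction k with
  | zero => simp
  | succ k ih => rw [pow_succ, FreeMonoid.length_mul, ih]; ring

theorem FreeMonoid.getElem?_toList_pow {α : Type*} (u : FreeMonoid α) (k i : ℕ)
    (hi : i < k * u.length) : (u ^ k).toList[i]? = u.toList[i % u.length]? := by
  induction k generalizing i with
  | zero => simp at hi
  | succ k ih =>
    rw [pow_succ', FreeMonoid.toList_mul, List.getElem?_append]
    split_ifs with h
    · have h0 : i % u.length = i := Nat.mod_eq_of_lt h
      rw [h0]
    · have h' : u.length ≤ i := not_lt.1 h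
      rw [ih _ (by rw [Nat.succ_mul] at hi; change i - u.length < _; omega)]
      change u.toList[(i - u.length) % u.length]? = _
      rw [Nat.mod_eq_sub_mod h']

/-- The periods form a subgroup of `ZMod m`, of order `h` say. If `w = u ^ k`, then the length of
`u` is a period of additive order `k`, so `k ∣ h`; conversely `m / h` is a period, and the prefix of
that length is an `h`-th root of `w`. -/
theorem coperiod_eq_card_periods {m : ℕ} [NeZero m] {w : FreeMonoid ℕ} (hm : w.length = m)
    {a : ZMod m → ℕ} (ha : ∀ i : ZMod m, w.toList[i.val]? = some (a i)) :
    coperiod w = (Finset.univ.filter fun k : ZMod m => ∀ j, a (j + k) = a j).card := by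
  classical
  have hm0 : m ≠ 0 := NeZero.ne m
  let H : AddSubgroup (ZMod m) :=
    { carrier := {k | ∀ j, a (j + k) = a j}
      zero_mem' := by simp
      add_mem' := by
        intro x y hx hy j
        rw [← add_assoc, hy, hx]
      neg_mem' := by
        intro x hx j
        rw [← hx (j + -x), neg_add_cancel_right] }
  have hH : ∀ k, k ∈ H ↔ ∀ j, a (j + k) = a j := fun k => Iff.rfl
  set h := (Finset.univ.filter fun k : ZMod m => ∀ j, a (j + k) = a j).card with hh
  have hcard : Nat.card H = h := by
    rw [Nat.card_eq_fintype_card, hh]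
    exact Fintype.card_of_subtype _ fun x => by simp [hH]
  have hpos : 0 < h := by rw [← hcard]; exact Nat.card_pos
  have hdvd : h ∣ m := by
    have := H.card_addSubgroup_dvd_card
    rwa [hcard, Nat.card_eq_fintype_card, ZMod.card] at this
  have hle : ∀ k, (∃ u : FreeMonoid ℕ, w = u ^ k) → k ≤ h := by
    rintro k ⟨u, hu⟩
    set d := u.length with hd
    have hkd : m = k * d := by rw [← hm, hu, FreeMonoid.length_pow]
    have hd0 : 0 < d := Nat.pos_of_ne_zero fun h0 => hm0 (by rw [hkd, h0, mul_zero])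
    have hval : ∀ i : ZMod m, u.toList[i.val % d]? = some (a i) := by
      intro i
      rw [← ha i, hu, FreeMonoid.getElem?_toList_pow]
      rw [← hd, ← hkd]
      exact ZMod.val_lt i
    have hmem : (d : ZMod m) ∈ H := by
      intro j
      have e : (j + (d : ZMod m)).val % d = j.val % d := by
        rw [ZMod.val_add, ZMod.val_natCast, Nat.mod_mod_of_dvd _ ⟨k, by rw [hkd, mul_comm]⟩,
          Nat.add_mod, Nat.mod_mod_of_dvd _ ⟨k, by rw [hkd, mul_comm]⟩, Nat.mod_self, add_zero,
          Nat.mod_mod]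
      have := hval (j + d)
      rw [e, hval j] at this
      exact (Option.some.inj this).symm
    have hord : addOrderOf (d : ZMod m) = k := by
      rw [ZMod.addOrderOf_coe _ hm0, hkd, Nat.gcd_mul_left_left, Nat.mul_div_cancel _ hd0]
    have h1 : addOrderOf (⟨d, hmem⟩ : H) ∣ Nat.card H := addOrderOf_dvd_natCard _
    rw [AddSubgroup.addOrderOf_mk, hord, hcard] at h1
    exact Nat.le_of_dvd hpos h1
  have hex : ∃ u : FreeMonoid ℕ, w = u ^ h := by
    obtain ⟨d, hd⟩ := hdvd
    have hd0 : 0 < d := Nat.pos_of_ne_zero fun h0 => hm0 (by rw [hd, h0, mul_zero])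
    -- In a cyclic group at most `h` elements are killed by `h`. The subgroup of periods has order
    -- `h`, so it consists of all of them, and in particular contains `d = m / h`.
    have hsub : (Finset.univ.filter fun k : ZMod m => ∀ j, a (j + k) = a j) ⊆
        Finset.univ.filter fun k : ZMod m => h • k = 0 := by
      intro k hk
      simp only [Finset.mem_filter, Finset.mem_univ, true_and] at hk ⊢
      have := card_nsmul_eq_zero' (G := H) (x := ⟨k, hk⟩)
      rw [hcard] at this
      exact congrArg Subtype.val this
    have heq := Finset.eq_of_subset_of_card_le hsub (IsAddCyclic.card_nsmul_eq_zero_le hpos)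
    have hper : ∀ j : ZMod m, a (j + d) = a j := by
      have : (d : ZMod m) ∈ Finset.univ.filter fun k : ZMod m => h • k = 0 := by
        simp only [Finset.mem_filter, Finset.mem_univ, true_and, nsmul_eq_mul]
        rw [← Nat.cast_mul, ← hd, ZMod.natCast_self]
      rw [← heq] at this
      exact (Finset.mem_filter.1 this).2
    have hper' : ∀ i : ℕ, a (i : ZMod m) = a ((i % d : ℕ) : ZMod m) := by
      intro i
      have key : ∀ q : ℕ, a (((i % d : ℕ) : ZMod m) + (q * d : ℕ)) = a ((i % d : ℕ) : ZMod m) := by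
        intro q
        induction q with
        | zero => simp
        | succ q ih =>
          rw [Nat.succ_mul, Nat.cast_add, ← add_assoc, hper, ih]
      have := key (i / d)
      rwa [← Nat.cast_add, mul_comm, Nat.mod_add_div] at this
    have hwi : ∀ i < m, w.toList[i]? = some (a i) := by
      intro i hi
      have := ha (i : ZMod m)
      rwa [ZMod.val_natCast, Nat.mod_eq_of_lt hi] at this
    have hdm : d ≤ m := by rw [hd]; exact Nat.le_mul_of_pos_left d hpos
    refine ⟨FreeMonoid.ofList (w.toList.take d), ?_⟩
    have hul : (FreeMonoid.ofList (w.toList.take d)).length = d := by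
      change (w.toList.take d).length = d
      rw [List.length_take]
      change min d w.length = d
      omega
    apply FreeMonoid.toList.injective
    apply List.ext_getElem?
    intro i
    by_cases hi : i < m
    · rw [FreeMonoid.getElem?_toList_pow _ _ _ (by rw [hul, ← hd]; exact hi), hul,
        FreeMonoid.toList_ofList, List.getElem?_take, if_pos (Nat.mod_lt _ hd0), hwi i hi,
        hwi _ ((Nat.mod_lt _ hd0).trans_le hdm), hper']
    · rw [List.getElem?_eq_none, List.getElem?_eq_none]
      · change FreeMonoid.length _ ≤ i
        rw [FreeMonoid.length_pow, hul, ← hd]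
        omega
      · change w.length ≤ i
        omega
  unfold coperiod
  exact IsGreatest.csSup_eq ⟨hex, fun k hk => hle k hk⟩

end Coperiod

/-! ### The trace polynomial: mean and concentration of its squared gradient. -/

theorem sub_single_add {E : Type*} {α : E →₀ ℕ} {e : E} (h : α e ≠ 0) :
    α - Finsupp.single e 1 + Finsupp.single e 1 = α :=
  tsub_add_cancel_of_le (Finsupp.single_le_iff.2 (Nat.one_le_iff_ne_zero.2 h))

section WalkPolynomial

variable {m : ℕ} [NeZero m] {V L : Type*} [Fintype V] [Fintype L]

/-- The polynomial `c ∑ₓ Z^(edges of x)`, summed over the closed walks `x`. -/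
noncomputable def walkPoly (a : ZMod m → L) (A : V → V → Prop) (c : ℝ) :
    MvPolynomial (L × V × V) ℂ :=
  ∑ x ∈ closedWalks m A, MvPolynomial.monomial (edgeCount a x) (c : ℂ)

theorem isHomogeneous_walkPoly (a : ZMod m → L) (A : V → V → Prop) (c : ℝ) :
    (walkPoly a A c).IsHomogeneous m := by
  refine MvPolynomial.IsHomogeneous.sum _ _ _ fun x _ => ?_
  refine MvPolynomial.isHomogeneous_monomial _ ?_
  rw [Finsupp.degree_eq_sum, sum_edgeCount]

theorem eval_walkPoly {L : Type*} (a : ZMod m → L) (A : V → V → Prop) (c : ℝ) (z : L × V × V → ℂ) :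
    MvPolynomial.eval z (walkPoly a A c) =
      c * ∑ x ∈ closedWalks m A, ∏ k, z (a k, x k, x (k + 1)) := by
  rw [walkPoly, map_sum, Finset.mul_sum]
  refine Finset.sum_congr rfl fun x _ => ?_
  rw [edgeCount, MvPolynomial.monomial_sum_index, map_mul, map_prod, MvPolynomial.eval_C]
  simp [walkEdge, MvPolynomial.eval_monomial]

/-- The index `τ` is a triple `(e, x, y)`: an edge `e` is removed from both walks. When `e` is
missing from one of them the truncated subtraction is harmless, because the coefficient vanishes. -/
theorem gradSq_walkPoly (a : ZMod m → L) (A : V → V → Prop) (c : ℝ) (z : L × V × V → ℂ) :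
    (gradSq (walkPoly a A c) z : ℂ) =
      ∑ τ ∈ Finset.univ ×ˢ (closedWalks m A ×ˢ closedWalks m A),
        ((c ^ 2 * (edgeCount a τ.2.1 τ.1 * edgeCount a τ.2.2 τ.1) : ℝ) : ℂ) *
          (mono (edgeCount a τ.2.1 - Finsupp.single τ.1 1) z *
            (starRingEnd ℂ) (mono (edgeCount a τ.2.2 - Finsupp.single τ.1 1) z)) := by
  rw [Finset.sum_product, gradSq]
  rw [Complex.ofReal_sum]
  refine Finset.sum_congr rfl fun e _ => ?_
  have h : MvPolynomial.eval z (MvPolynomial.pderiv e (walkPoly a A c)) =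
      ∑ x ∈ closedWalks m A, (c * edgeCount a x e) *
        mono (edgeCount a x - Finsupp.single e 1) z := by
    rw [walkPoly, map_sum, map_sum]
    refine Finset.sum_congr rfl fun x _ => ?_
    rw [MvPolynomial.pderiv_monomial, eval_monomial_eq_mono]
  rw [← Complex.normSq_eq_norm_sq, ← Complex.mul_conj, h, map_sum,
    Finset.sum_mul_sum, Finset.sum_product]
  refine Finset.sum_congr rfl fun x _ => Finset.sum_congr rfl fun y _ => ?_
  simp only [map_mul, Complex.conj_ofReal, map_natCast]
  push_cast
  ring

theorem sum_sub_single_le (a : ZMod m → L) (x : ZMod m → V) (e : L × V × V) :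
    ∑ f, (edgeCount a x - Finsupp.single e 1 : L × V × V →₀ ℕ) f ≤ m := by
  refine (Finset.sum_le_sum fun f _ => ?_).trans (sum_edgeCount a x).le
  rw [Finsupp.tsub_apply]
  exact Nat.sub_le _ _

-- Every vertex of `y` is the source of an edge of `x` or `x'`, which leaves at most `2m` choices
-- per position. The bound does not depend on the size of the graph.
open Classical in
theorem card_walks_on_le (a : ZMod m → L) (A : V → V → Prop) (x x' : ZMod m → V) :
    ((closedWalks m A).filter fun y => ∀ e, edgeCount a y e ≠ 0 →
      edgeCount a x e ≠ 0 ∨ edgeCount a x' e ≠ 0).card ≤ (2 * m) ^ m := by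
  refine (Finset.card_le_card (t := Fintype.piFinset fun _ : ZMod m =>
    Finset.univ.image x ∪ Finset.univ.image x') ?_).trans ?_
  · intro y hy
    rw [Finset.mem_filter] at hy
    rw [Fintype.mem_piFinset]
    intro j
    rw [Finset.mem_union, Finset.mem_image, Finset.mem_image]
    rcases hy.2 _ (edgeCount_ne_zero_iff.2 ⟨j, rfl⟩) with h | h
    all_goals
      obtain ⟨k, hk⟩ := edgeCount_ne_zero_iff.1 h
      simp only [walkEdge, Prod.mk.injEq] at hk
    · exact Or.inl ⟨k, Finset.mem_univ _, hk.2.1⟩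
    · exact Or.inr ⟨k, Finset.mem_univ _, hk.2.1⟩
  · rw [Fintype.card_piFinset, Finset.prod_const, Finset.card_univ, ZMod.card]
    refine Nat.pow_le_pow_left ((Finset.card_union_le _ _).trans ?_) m
    have h1 := Finset.card_image_le (s := Finset.univ) (f := x)
    have h2 := Finset.card_image_le (s := Finset.univ) (f := x')
    rw [Finset.card_univ, ZMod.card] at h1 h2
    omega

/-- The covariance of two products of the gradient vanishes unless the edges match and the walks
meet. -/
theorem matching_of_covariance_ne_zero {a : ZMod m → L} {x y x' y' : ZMod m → V}
    {e e' : L × V × V} (hx : edgeCount a x e ≠ 0) (hy : edgeCount a y e ≠ 0)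
    (hx' : edgeCount a x' e' ≠ 0) (hy' : edgeCount a y' e' ≠ 0)
    (h : mixedMoment (edgeCount a x - Finsupp.single e 1 + (edgeCount a x' - Finsupp.single e' 1))
        (edgeCount a y - Finsupp.single e 1 + (edgeCount a y' - Finsupp.single e' 1)) -
      mixedMoment (edgeCount a x - Finsupp.single e 1) (edgeCount a y - Finsupp.single e 1) *
        mixedMoment (edgeCount a x' - Finsupp.single e' 1)
          (edgeCount a y' - Finsupp.single e' 1) ≠ 0) :
    edgeCount a x + edgeCount a x' = edgeCount a y + edgeCount a y' ∧ ∃ j k, x j = x' k := by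
  set α := edgeCount a x - Finsupp.single e 1 with hα
  set β := edgeCount a y - Finsupp.single e 1 with hβ
  set α' := edgeCount a x' - Finsupp.single e' 1 with hα'
  set β' := edgeCount a y' - Finsupp.single e' 1 with hβ'
  -- If the edges do not match jointly, they do not match in both pairs separately either, so the
  -- joint moment and the product of moments are both zero.
  have h1 : α + α' = β + β' := by
    by_contra hne
    apply h
    have h2 : ¬ (α = β ∧ α' = β') := fun h => hne (by rw [h.1, h.2])
    unfold mixedMoment
    rw [if_neg hne]
    by_cases h3 : α = β
    · have h4 : α' ≠ β' := fun h4 => h2 ⟨h3, h4⟩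
      simp [h4]
    · simp [h3]
  have hsum : edgeCount a x + edgeCount a x' = edgeCount a y + edgeCount a y' := by
    rw [← sub_single_add hx, ← sub_single_add hy, ← sub_single_add hx', ← sub_single_add hy',
      ← hα, ← hβ, ← hα', ← hβ', add_add_add_comm, h1, add_add_add_comm]
  refine ⟨hsum, ?_⟩
  by_contra! hd
  apply h
  have hxy := edgeCount_eq_of_disjoint hd hx hy hsum
  have hxy' : edgeCount a x' = edgeCount a y' := by
    rw [hxy] at hsum
    exact add_left_cancel hsum
  have h3 : α = β := by rw [hα, hβ, hxy]
  have h4 : α' = β' := by rw [hα', hβ', hxy']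
  -- Walks without a common vertex share no edge, so the two factors involve disjoint sets of
  -- variables: the joint moment factorizes and the covariance is zero.
  have hdis : ∀ f, α f = 0 ∨ α' f = 0 := by
    intro f
    by_contra! hf
    have h5 : edgeCount a x f ≠ 0 := fun h => hf.1 (by rw [hα, Finsupp.tsub_apply, h, Nat.zero_sub])
    have h6 : edgeCount a x' f ≠ 0 := fun h =>
      hf.2 (by rw [hα', Finsupp.tsub_apply, h, Nat.zero_sub])
    obtain ⟨j, rfl⟩ := edgeCount_ne_zero_iff.1 h5
    obtain ⟨k, hk⟩ := edgeCount_ne_zero_iff.1 h6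
    simp only [walkEdge, Prod.mk.injEq] at hk
    exact hd j k hk.2.1.symm
  rw [← h3, ← h4]
  simp [mixedMoment, wick_add_of_disjoint hdis]

/-- A constant for the concentration of the gradient, depending only on the length. -/
noncomputable def varianceConst (m : ℕ) : ℝ :=
  m ^ 4 * momentBound (2 * m) ^ (2 * m) * (m * m * ((2 * m) ^ m * (2 * m) ^ m) * m ^ 2)

open Classical in
theorem gradSq_walkPoly_concentration (a : ZMod m → L) {A : V → V → Prop} {l : ℕ}
    (hl : ∀ u, (Finset.univ.filter fun v => A u v).card ≤ l) (c : ℝ) :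
    (∫ z, |gradSq (walkPoly a A c) z - ∫ w, gradSq (walkPoly a A c) w ∂gaussianFamily (L × V × V)|
      ∂gaussianFamily (L × V × V)) ^ 2 ≤
      varianceConst m * (c ^ 4 * (Fintype.card V * (l ^ (m - 1) * l ^ (m - 1)))) := by
  refine (integral_sum_mono_sub_sq (gradSq_walkPoly a A c)).trans ?_
  set W := closedWalks m A with hW
  set T := (Finset.univ : Finset (L × V × V)) ×ˢ (W ×ˢ W) with hT
  rw [← Finset.sum_product']
  set K := momentBound (2 * m) ^ (2 * m) with hK
  have hK0 : 0 ≤ K := pow_nonneg (zero_le_one.trans (one_le_momentBound _)) _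
  -- `Q` contains every pair of triples with a non-zero term. It is counted by projecting to the two
  -- walks `(x, x')`, which must meet.
  set Q := (T ×ˢ T).filter fun p =>
    (edgeCount a p.1.2.1 p.1.1 ≠ 0 ∧ edgeCount a p.1.2.2 p.1.1 ≠ 0 ∧
    edgeCount a p.2.2.1 p.2.1 ≠ 0 ∧ edgeCount a p.2.2.2 p.2.1 ≠ 0) ∧
    edgeCount a p.1.2.1 + edgeCount a p.2.2.1 = edgeCount a p.1.2.2 + edgeCount a p.2.2.2 ∧
    ∃ j k, p.1.2.1 j = p.2.2.1 k with hQ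
  have hcardQ : Q.card ≤ (m * m * ((2 * m) ^ m * (2 * m) ^ m)) *
      (m ^ 2 * (Fintype.card V * (l ^ (m - 1) * l ^ (m - 1)))) := by
    refine (Finset.card_le_mul_card_image_of_maps_to (f := fun p => (p.1.2.1, p.2.2.1))
      (t := (W ×ˢ W).filter fun p : (ZMod m → V) × (ZMod m → V) => ∃ j k, p.1 j = p.2 k) ?_ _ ?_).trans
      (Nat.mul_le_mul_left _ (card_closedWalks_meeting_le hl))
    · rintro ⟨⟨e, x, y⟩, ⟨e', x', y'⟩⟩ hp
      simp only [hQ, hT, Finset.mem_filter, Finset.mem_product, Finset.mem_univ, true_and] at hp ⊢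
      exact ⟨⟨hp.1.1.1, hp.1.2.1⟩, hp.2.2.2⟩
    · rintro ⟨x, x'⟩ _
      have hcard : ((Finset.univ.image (walkEdge a x) ×ˢ Finset.univ.image (walkEdge a x')) ×ˢ
          ((W.filter fun y => ∀ e, edgeCount a y e ≠ 0 →
            edgeCount a x e ≠ 0 ∨ edgeCount a x' e ≠ 0) ×ˢ
          (W.filter fun y => ∀ e, edgeCount a y e ≠ 0 →
            edgeCount a x e ≠ 0 ∨ edgeCount a x' e ≠ 0))).card ≤
          m * m * ((2 * m) ^ m * (2 * m) ^ m) := by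
        have h1 : ∀ x : ZMod m → V, (Finset.univ.image (walkEdge a x)).card ≤ m := fun x =>
          Finset.card_image_le.trans (by rw [Finset.card_univ, ZMod.card])
        simp only [Finset.card_product]
        exact Nat.mul_le_mul (Nat.mul_le_mul (h1 _) (h1 _))
          (Nat.mul_le_mul (card_walks_on_le a A x x') (card_walks_on_le a A x x'))
      -- Once `x` and `x'` are given, the remaining data are the two removed edges, which lie on `x`
      -- and `x'`, and the walks `y` and `y'`, which use only edges of `x` and `x'`.
      refine le_trans (Finset.card_le_card_of_injOn
        (fun p => ((p.1.1, p.2.1), (p.1.2.2, p.2.2.2))) ?_ ?_) hcard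
      · rintro ⟨⟨e, x₁, y⟩, ⟨e', x₁', y'⟩⟩ hp
        simp only [hQ, hT, Finset.coe_filter, Finset.mem_filter, Finset.mem_product,
          Finset.mem_univ, true_and, Set.mem_ofPred_eq, Prod.mk.injEq] at hp
        obtain ⟨⟨⟨⟨_, hy⟩, _, hy'⟩, ⟨hxe, hye, hxe', hye'⟩, hs, _⟩, rfl, rfl⟩ := hp
        simp only [Finset.coe_product, Set.mem_prod, Finset.mem_coe, Finset.mem_image,
          Finset.mem_univ, true_and, Finset.mem_filter]
        refine ⟨⟨edgeCount_ne_zero_iff.1 hxe, edgeCount_ne_zero_iff.1 hxe'⟩,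
          ⟨hy, fun f hf => ?_⟩, hy', fun f hf => ?_⟩
        all_goals
          have := DFunLike.congr_fun hs f
          simp only [Finsupp.add_apply] at this
          omega
      · rintro ⟨⟨e, x₁, y⟩, ⟨e', x₁', y'⟩⟩ hp ⟨⟨f, x₂, z⟩, ⟨f', x₂', z'⟩⟩ hq h
        simp only [Finset.coe_filter, Set.mem_ofPred_eq, Prod.mk.injEq] at hp hq h ⊢
        obtain ⟨_, rfl, rfl⟩ := hp
        obtain ⟨_, rfl, rfl⟩ := hq
        tauto
  have hterm : ∀ p ∈ T ×ˢ T,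
      (c ^ 2 * (edgeCount a p.1.2.1 p.1.1 * edgeCount a p.1.2.2 p.1.1) : ℝ) *
        (c ^ 2 * (edgeCount a p.2.2.1 p.2.1 * edgeCount a p.2.2.2 p.2.1)) *
      (mixedMoment (edgeCount a p.1.2.1 - Finsupp.single p.1.1 1 +
          (edgeCount a p.2.2.1 - Finsupp.single p.2.1 1))
        (edgeCount a p.1.2.2 - Finsupp.single p.1.1 1 +
          (edgeCount a p.2.2.2 - Finsupp.single p.2.1 1)) -
      mixedMoment (edgeCount a p.1.2.1 - Finsupp.single p.1.1 1)
          (edgeCount a p.1.2.2 - Finsupp.single p.1.1 1) *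
        mixedMoment (edgeCount a p.2.2.1 - Finsupp.single p.2.1 1)
          (edgeCount a p.2.2.2 - Finsupp.single p.2.1 1)) ≤
      if p ∈ Q then c ^ 4 * (m ^ 4 * K) else 0 := by
    rintro ⟨⟨e, x, y⟩, ⟨e', x', y'⟩⟩ hp
    simp only
    have hle : ∀ (x : ZMod m → V) e, (edgeCount a x e : ℝ) ≤ m := fun x e => by
      exact_mod_cast edgeCount_le a x e
    split_ifs with hq
    · have hcov : mixedMoment (edgeCount a x - Finsupp.single e 1 +
          (edgeCount a x' - Finsupp.single e' 1)) (edgeCount a y - Finsupp.single e 1 +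
          (edgeCount a y' - Finsupp.single e' 1)) -
          mixedMoment (edgeCount a x - Finsupp.single e 1)
          (edgeCount a y - Finsupp.single e 1) *
        mixedMoment (edgeCount a x' - Finsupp.single e' 1)
          (edgeCount a y' - Finsupp.single e' 1) ≤ K := by
        have h1 := mul_nonneg (mixedMoment_nonneg (edgeCount a x - Finsupp.single e 1)
          (edgeCount a y - Finsupp.single e 1)) (mixedMoment_nonneg
            (edgeCount a x' - Finsupp.single e' 1) (edgeCount a y' - Finsupp.single e' 1))
        refine (sub_le_self _ h1).trans (mixedMoment_le _ _ ?_)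
        simp only [Finsupp.add_apply]
        rw [Finset.sum_add_distrib, two_mul]
        exact add_le_add (sum_sub_single_le a x e) (sum_sub_single_le a x' e')
      calc _ ≤ (c ^ 2 * (m * m)) * (c ^ 2 * (m * m)) * K := by
            have := hle x e
            have := hle x' e'
            have := hle y e
            have := hle y' e'
            refine (mul_le_mul_of_nonneg_left hcov (by positivity)).trans ?_
            gcongr
        _ = c ^ 4 * (m ^ 4 * K) := by ring
    · apply le_of_eq
      by_contra hne
      apply hq
      rw [hQ, Finset.mem_filter]
      simp only [mul_ne_zero_iff, Nat.cast_ne_zero, ne_eq] at hne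
      obtain ⟨⟨⟨_, h1, h2⟩, _, h3, h4⟩, h5⟩ := hne
      exact ⟨hp, ⟨h1, h2, h3, h4⟩, matching_of_covariance_ne_zero h1 h2 h3 h4 h5⟩
  refine (Finset.sum_le_sum hterm).trans ?_
  rw [← Finset.sum_filter, Finset.sum_const, nsmul_eq_mul]
  have hsub : ((T ×ˢ T).filter fun p => p ∈ Q).card ≤ Q.card :=
    Finset.card_le_card fun p hp => (Finset.mem_filter.1 hp).2
  have hcast : (((T ×ˢ T).filter fun p => p ∈ Q).card : ℝ) ≤ ((m * m * ((2 * m) ^ m * (2 * m) ^ m)) *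
      (m ^ 2 * (Fintype.card V * (l ^ (m - 1) * l ^ (m - 1)))) : ℝ) := by
    exact_mod_cast hsub.trans hcardQ
  refine (mul_le_mul_of_nonneg_right hcast (by positivity)).trans (le_of_eq ?_)
  rw [varianceConst, ← hK]
  ring

/-- A constant for the contribution of the walks that visit a vertex twice. -/
noncomputable def meanConst (m : ℕ) : ℝ := (2 * m) ^ m * (m ^ 2 * momentBound m ^ m)

open Classical in
theorem abs_integral_gradSq_walkPoly_sub_le (a : ZMod m → L) {A : V → V → Prop} {l : ℕ}
    (hl : ∀ u, (Finset.univ.filter fun v => A u v).card ≤ l) (c : ℝ) {p : ℕ}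
    (hp : (Finset.univ.filter fun k : ZMod m => ∀ j, a (j + k) = a j).card = p) :
    |∫ z, gradSq (walkPoly a A c) z ∂gaussianFamily (L × V × V) -
      c ^ 2 * (m * p * (closedWalks m A).card)| ≤
      c ^ 2 * ((m * p + meanConst m) * ((m * m - m : ℕ) * (Fintype.card V * l ^ (m - 2)))) := by
  rw [integral_sum_mono (gradSq_walkPoly a A c)]
  set W := closedWalks m A with hW
  -- `q x y` is the total contribution of a pair of walks, summed over the removed edge. It vanishes
  -- unless both walks have the same edge multiplicities.
  set q : (ZMod m → V) → (ZMod m → V) → ℝ := fun x y =>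
    ∑ e, (edgeCount a x e * edgeCount a y e : ℝ) *
      mixedMoment (edgeCount a x - Finsupp.single e 1) (edgeCount a y - Finsupp.single e 1) with hq
  have hsum : ∑ τ ∈ Finset.univ ×ˢ (W ×ˢ W),
        (c ^ 2 * (edgeCount a τ.2.1 τ.1 * edgeCount a τ.2.2 τ.1) : ℝ) *
        mixedMoment (edgeCount a τ.2.1 - Finsupp.single τ.1 1)
          (edgeCount a τ.2.2 - Finsupp.single τ.1 1) = c ^ 2 * ∑ x ∈ W, ∑ y ∈ W, q x y := by
    rw [Finset.sum_product_right, Finset.sum_product, Finset.mul_sum]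
    refine Finset.sum_congr rfl fun x _ => ?_
    rw [Finset.mul_sum]
    refine Finset.sum_congr rfl fun y _ => ?_
    rw [hq, Finset.mul_sum]
    refine Finset.sum_congr rfl fun e _ => ?_
    ring
  have hq0 : ∀ x y, 0 ≤ q x y := fun x y => Finset.sum_nonneg fun e _ =>
    mul_nonneg (by positivity) (mixedMoment_nonneg _ _)
  have hqne : ∀ x y, edgeCount a y ≠ edgeCount a x → q x y = 0 := by
    intro x y hxy
    refine Finset.sum_eq_zero fun e _ => ?_
    by_contra hne
    simp only [mul_ne_zero_iff, Nat.cast_ne_zero] at hne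
    obtain ⟨⟨h1, h2⟩, h3⟩ := hne
    apply h3
    unfold mixedMoment
    rw [if_neg]
    intro h
    apply hxy
    rw [← sub_single_add h1, ← sub_single_add h2, h]
  -- An injective walk has simple edges, so every partner contributes `1` for each of the `m`
  -- removed edges; the partners are the shifts by the `p` periods.
  have hinj : ∀ x ∈ W, Function.Injective x → ∑ y ∈ W, q x y = m * p := by
    intro x hx hxi
    have h1 : ∀ y, edgeCount a y = edgeCount a x → q x y = m := by
      intro y hy
      rw [← sum_edgeCount a x, hq]
      push_cast
      refine Finset.sum_congr rfl fun e _ => ?_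
      have h2 := edgeCount_le_one hxi (a := a) e
      rw [hy, mixedMoment, if_pos rfl, wick_eq_one]
      · interval_cases edgeCount a x e <;> simp
      · intro f
        rw [Finsupp.tsub_apply]
        exact (Nat.sub_le _ _).trans (edgeCount_le_one hxi f)
    rw [← Finset.sum_filter_of_ne (p := fun y => edgeCount a y = edgeCount a x)
      (fun y _ h => by_contra fun h' => h (hqne x y h')),
      Finset.sum_congr rfl (fun y hy => h1 y (Finset.mem_filter.1 hy).2), Finset.sum_const,
      card_edgeCount_eq hxi hx, hp, nsmul_eq_mul, mul_comm]
  have hbd : ∀ x, ∑ y ∈ W, q x y ≤ meanConst m := by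
    intro x
    have h1 : ∀ y, q x y ≤ m ^ 2 * momentBound m ^ m := by
      intro y
      calc q x y ≤ ∑ e, (edgeCount a x e * m : ℝ) * momentBound m ^ m := by
            refine Finset.sum_le_sum fun e _ => ?_
            have h2 : (edgeCount a y e : ℝ) ≤ m := by exact_mod_cast edgeCount_le a y e
            have h3 := mixedMoment_le (edgeCount a x - Finsupp.single e 1)
              (edgeCount a y - Finsupp.single e 1) (sum_sub_single_le a x e)
            have h4 := mixedMoment_nonneg (edgeCount a x - Finsupp.single e 1)
              (edgeCount a y - Finsupp.single e 1)
            gcongr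
        _ = m ^ 2 * momentBound m ^ m := by
            rw [← Finset.sum_mul, ← Finset.sum_mul, ← Nat.cast_sum, sum_edgeCount, sq]
    rw [← Finset.sum_filter_of_ne (p := fun y => edgeCount a y = edgeCount a x)
      (fun y _ h => by_contra fun h' => h (hqne x y h'))]
    refine (Finset.sum_le_card_nsmul _ _ _ fun y _ => h1 y).trans ?_
    rw [nsmul_eq_mul, meanConst]
    have h2 : ((W.filter fun y => edgeCount a y = edgeCount a x).card : ℝ) ≤ (2 * m) ^ m := by
      have hsub : (W.filter fun y => edgeCount a y = edgeCount a x) ⊆ W.filter fun y =>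
          ∀ e, edgeCount a y e ≠ 0 → edgeCount a x e ≠ 0 ∨ edgeCount a x e ≠ 0 := by
        intro y hy
        rw [Finset.mem_filter] at hy ⊢
        exact ⟨hy.1, fun e he => by rw [hy.2] at he; exact Or.inl he⟩
      exact_mod_cast (Finset.card_le_card hsub).trans (card_walks_on_le a A x x)
    have := one_le_momentBound m
    gcongr
  have hM : 0 ≤ meanConst m := by
    have := one_le_momentBound m
    unfold meanConst
    positivity
  -- Injective walks contribute exactly `m * p`, so only non-injective ones enter the error, and
  -- each of these has a bounded contribution.
  have hdiff : ∑ x ∈ W, ∑ y ∈ W, q x y - m * p * W.card =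
      ∑ x ∈ W.filter fun x => ¬ Function.Injective x, (∑ y ∈ W, q x y - m * p) := by
    rw [Finset.sum_filter_of_ne, Finset.sum_sub_distrib, Finset.sum_const, nsmul_eq_mul]
    · ring
    · intro x hx h hxi
      exact h (by rw [hinj x hx hxi, sub_self])
  rw [hsum, ← mul_sub, hdiff, abs_mul, abs_of_nonneg (sq_nonneg c)]
  refine mul_le_mul_of_nonneg_left ?_ (sq_nonneg c)
  refine (Finset.abs_sum_le_sum_abs _ _).trans ((Finset.sum_le_card_nsmul _ _
    (m * p + meanConst m) fun x _ => ?_).trans ?_)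
  · rw [abs_le]
    have h1 := hbd x
    have h2 := Finset.sum_nonneg fun y (_ : y ∈ W) => hq0 x y
    have h3 : (0 : ℝ) ≤ m * p := by positivity
    constructor <;> linarith
  · rw [nsmul_eq_mul, mul_comm]
    refine mul_le_mul_of_nonneg_left ?_ (by positivity)
    exact_mod_cast card_closedWalks_not_injective_le hl

end WalkPolynomial

/-! ### The Dirichlet integral and the integrability of powers of sinc. -/

section Dirichlet

/-- `∫ₜ^∞ sin x / x dx`, written as a Laplace transform. -/
noncomputable def sinTail (t : ℝ) : ℝ :=
  ∫ s in Set.Ioi (0 : ℝ), Real.exp (-(t * s)) * (Real.cos t + s * Real.sin t) * (1 + s ^ 2)⁻¹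

/-- Since `|cos t + s sin t| ≤ 1 + s t ≤ exp (t s)`, the exponential absorbs the growth. The bound
does not depend on `t`, so it serves for the limits both at `0` and at infinity. -/
theorem abs_sinTail_integrand_le {t s : ℝ} (ht : 0 < t) (hs : 0 < s) :
    ‖Real.exp (-(t * s)) * (Real.cos t + s * Real.sin t) * (1 + s ^ 2)⁻¹‖ ≤
      2 * (1 + s ^ 2)⁻¹ := by
  rw [norm_mul, norm_mul, Real.norm_of_nonneg (Real.exp_pos _).le,
    Real.norm_of_nonneg (by positivity : (0 : ℝ) ≤ (1 + s ^ 2)⁻¹)]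
  refine mul_le_mul_of_nonneg_right ?_ (by positivity)
  have h1 : |Real.cos t + s * Real.sin t| ≤ 1 + s * t := by
    refine (abs_add_le _ _).trans (add_le_add (Real.abs_cos_le_one t) ?_)
    rw [abs_mul, abs_of_pos hs]
    exact mul_le_mul_of_nonneg_left (Real.abs_sin_le_abs.trans (abs_of_pos ht).le) hs.le
  have h2 : 1 + s * t ≤ Real.exp (t * s) := by
    have := Real.add_one_le_exp (t * s)
    linarith
  calc Real.exp (-(t * s)) * ‖Real.cos t + s * Real.sin t‖
      ≤ Real.exp (-(t * s)) * Real.exp (t * s) := by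
        rw [Real.norm_eq_abs]
        gcongr
        exact h1.trans h2
    _ = 1 := by rw [← Real.exp_add]; simp
    _ ≤ 2 := by norm_num

theorem integrable_sinTail_bound :
    Integrable (fun s : ℝ => 2 * (1 + s ^ 2)⁻¹) (volume.restrict (Set.Ioi 0)) :=
  (integrable_inv_one_add_sq.const_mul 2).restrict

/-- Differentiating in `t` cancels the denominator `1 + s ^ 2` and leaves `-sin t * exp (-(t s))`,
whose integral over `s > 0` is elementary. -/
theorem hasDerivAt_sinTail {t : ℝ} (ht : 0 < t) : HasDerivAt sinTail (-Real.sinc t) t := by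
  have hd := (hasDerivAt_integral_of_dominated_loc_of_deriv_le (𝕜 := ℝ) (x₀ := t)
    (μ := volume.restrict (Set.Ioi (0 : ℝ))) (s := Set.Ioi (t / 2))
    (F := fun t s => Real.exp (-(t * s)) * (Real.cos t + s * Real.sin t) * (1 + s ^ 2)⁻¹)
    (F' := fun t s => -(Real.sin t * Real.exp (-(t * s))))
    (bound := fun s => Real.exp (-(t / 2) * s)) (Ioi_mem_nhds (by linarith)) ?_ ?_ ?_ ?_ ?_ ?_).2
  · refine hd.congr_deriv ?_
    rw [integral_neg, integral_const_mul]
    have : ∫ s in Set.Ioi (0 : ℝ), Real.exp (-(t * s)) = 1 / t := by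
      have := integral_exp_mul_Ioi (a := -t) (by linarith) 0
      simp only [mul_zero, Real.exp_zero, neg_mul] at this
      rw [this]
      field_simp
    rw [this, Real.sinc_of_ne_zero ht.ne']
    ring
  · exact Eventually.of_forall fun _ => by fun_prop
  · refine integrable_sinTail_bound.mono' (by fun_prop) ?_
    filter_upwards [ae_restrict_mem measurableSet_Ioi] with s hs
    exact abs_sinTail_integrand_le ht hs
  · fun_prop
  · filter_upwards [ae_restrict_mem measurableSet_Ioi] with s hs u hu
    rw [norm_neg, norm_mul, Real.norm_of_nonneg (Real.exp_pos _).le, Real.norm_eq_abs]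
    calc |Real.sin u| * Real.exp (-(u * s)) ≤ 1 * Real.exp (-(t / 2) * s) := by
          refine mul_le_mul (Real.abs_sin_le_one u) (Real.exp_le_exp.2 ?_) (Real.exp_pos _).le
            zero_le_one
          have := mul_le_mul_of_nonneg_right (le_of_lt (Set.mem_Ioi.1 hu)) (le_of_lt hs)
          linarith
      _ = _ := one_mul _
  · exact integrableOn_exp_mul_Ioi (by linarith) 0
  · filter_upwards [ae_restrict_mem measurableSet_Ioi] with s hs u hu
    have h1 : HasDerivAt (fun u : ℝ => Real.exp (-(u * s))) (Real.exp (-(u * s)) * (-s)) u := by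
      have := ((hasDerivAt_id u).mul_const s).neg.exp
      simpa using this
    have h2 : HasDerivAt (fun u : ℝ => Real.cos u + s * Real.sin u)
        (-Real.sin u + s * Real.cos u) u :=
      (Real.hasDerivAt_cos u).add ((Real.hasDerivAt_sin u).const_mul s)
    refine ((h1.mul h2).mul_const _).congr_deriv ?_
    have : (1 + s ^ 2) ≠ 0 := by positivity
    field_simp
    ring

theorem tendsto_sinTail_zero : Tendsto sinTail (𝓝[>] 0) (𝓝 (Real.pi / 2)) := by
  have h : ∫ s in Set.Ioi (0 : ℝ), (1 + s ^ 2)⁻¹ = Real.pi / 2 := by simp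
  rw [← h]
  refine tendsto_integral_filter_of_dominated_convergence (fun s => 2 * (1 + s ^ 2)⁻¹)
    (Eventually.of_forall fun _ => by fun_prop) ?_ integrable_sinTail_bound ?_
  · filter_upwards [self_mem_nhdsWithin] with t ht
    filter_upwards [ae_restrict_mem measurableSet_Ioi] with s hs
    exact abs_sinTail_integrand_le ht hs
  · refine ae_of_all _ fun s => ?_
    have : Continuous fun t : ℝ =>
        Real.exp (-(t * s)) * (Real.cos t + s * Real.sin t) * (1 + s ^ 2)⁻¹ := by fun_prop
    have h0 := (this.tendsto 0).mono_left (nhdsWithin_le_nhds (s := Set.Ioi 0))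
    simpa using h0

theorem tendsto_sinTail_atTop : Tendsto sinTail atTop (𝓝 0) := by
  have h : ∫ _ in Set.Ioi (0 : ℝ), (0 : ℝ) = 0 := by simp
  rw [← h]
  refine tendsto_integral_filter_of_dominated_convergence (fun s => 2 * (1 + s ^ 2)⁻¹)
    (Eventually.of_forall fun _ => by fun_prop) ?_ integrable_sinTail_bound ?_
  · filter_upwards [eventually_gt_atTop 0] with t ht
    filter_upwards [ae_restrict_mem measurableSet_Ioi] with s hs
    exact abs_sinTail_integrand_le ht hs
  · filter_upwards [ae_restrict_mem measurableSet_Ioi] with s hs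
    have hs0 : (0 : ℝ) < s := hs
    have h1 : Tendsto (fun t : ℝ => Real.exp (-(t * s))) atTop (𝓝 0) :=
      Real.tendsto_exp_neg_atTop_nhds_zero.comp (tendsto_id.atTop_mul_const hs0)
    have h2 := h1.zero_mul_isBoundedUnder_le
      (g := fun t : ℝ => Real.cos t + s * Real.sin t)
      (isBoundedUnder_of ⟨1 + s, fun t => by
        simp only [Function.comp, Real.norm_eq_abs]
        refine (abs_add_le _ _).trans (add_le_add (Real.abs_cos_le_one t) ?_)
        rw [abs_mul, abs_of_pos hs0]
        exact mul_le_of_le_one_right hs0.le (Real.abs_sin_le_one t)⟩)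
    simpa using h2.mul_const ((1 + s ^ 2)⁻¹)

/-- The sum has zero derivative on `(0, ∞)`, so it equals its limit at `0`. -/
theorem integral_sinc_add_sinTail {t : ℝ} (ht : 0 < t) :
    (∫ x in (0 : ℝ)..t, Real.sinc x) + sinTail t = Real.pi / 2 := by
  have hF : ∀ t : ℝ, HasDerivAt (fun t => ∫ x in (0 : ℝ)..t, Real.sinc x) (Real.sinc t) t :=
    fun t => intervalIntegral.integral_hasDerivAt_right
      (Real.continuous_sinc.intervalIntegrable _ _)
      (Real.continuous_sinc.stronglyMeasurableAtFilter _ _) Real.continuous_sinc.continuousAt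
  have hd : ∀ u ∈ Set.Ioi (0 : ℝ), HasDerivAt
      (fun t => (∫ x in (0 : ℝ)..t, Real.sinc x) + sinTail t) 0 u := fun u hu =>
    ((hF u).add (hasDerivAt_sinTail hu)).congr_deriv (by ring)
  have hconst : ∀ u ∈ Set.Ioi (0 : ℝ), (∫ x in (0 : ℝ)..u, Real.sinc x) + sinTail u =
      (∫ x in (0 : ℝ)..t, Real.sinc x) + sinTail t := fun u hu =>
    (convex_Ioi (0 : ℝ)).is_const_of_fderivWithin_eq_zero (𝕜 := ℝ)
      (fun v hv => (hd v hv).differentiableAt.differentiableWithinAt)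
      (fun v hv => by
        rw [fderivWithin_of_isOpen isOpen_Ioi hv]
        ext
        simp [(hd v hv).deriv]) hu ht
  have h1 : Tendsto (fun t => (∫ x in (0 : ℝ)..t, Real.sinc x) + sinTail t) (𝓝[>] 0)
      (𝓝 (0 + Real.pi / 2)) := by
    refine Tendsto.add ?_ tendsto_sinTail_zero
    have := (hF 0).continuousAt.tendsto
    simp only [intervalIntegral.integral_same] at this
    exact this.mono_left nhdsWithin_le_nhds
  have h2 : Tendsto (fun t => (∫ x in (0 : ℝ)..t, Real.sinc x) + sinTail t) (𝓝[>] 0)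
      (𝓝 ((∫ x in (0 : ℝ)..t, Real.sinc x) + sinTail t)) :=
    tendsto_const_nhds.congr' (by
      filter_upwards [self_mem_nhdsWithin] with u hu
      exact (hconst u hu).symm)
  have := tendsto_nhds_unique h2 h1
  rw [this, zero_add]

/-- The Dirichlet integral. -/
theorem hasImproperIntegral_sinc : HasImproperIntegral Real.sinc Real.pi := by
  have h1 : Tendsto (fun t => ∫ x in (0 : ℝ)..t, Real.sinc x) atTop (𝓝 (Real.pi / 2)) := by
    have := (tendsto_const_nhds (x := Real.pi / 2)).sub tendsto_sinTail_atTop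
    rw [sub_zero] at this
    refine this.congr' ?_
    filter_upwards [eventually_gt_atTop 0] with t ht
    rw [← integral_sinc_add_sinTail ht]
    ring
  have h2 : Tendsto (fun s => ∫ x in s..(0 : ℝ), Real.sinc x) atBot (𝓝 (Real.pi / 2)) := by
    refine (h1.comp tendsto_neg_atBot_atTop).congr fun s => ?_
    have := intervalIntegral.integral_comp_neg (a := s) (b := 0) Real.sinc
    simp only [Real.sinc_neg, neg_zero] at this
    exact this.symm
  have h3 := (h2.comp tendsto_fst).add (h1.comp (tendsto_snd (f := atBot (α := ℝ))))
  rw [add_halves] at h3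
  refine h3.congr fun p => ?_
  exact intervalIntegral.integral_add_adjacent_intervals
    (Real.continuous_sinc.intervalIntegrable _ _) (Real.continuous_sinc.intervalIntegrable _ _)

theorem sinc_sq_le (x : ℝ) : Real.sinc x ^ 2 ≤ 2 * (1 + x ^ 2)⁻¹ := by
  rw [← div_eq_mul_inv, le_div_iff₀ (by positivity)]
  have h1 : Real.sinc x ^ 2 ≤ 1 := by
    rw [← sq_abs]
    exact pow_le_one₀ (abs_nonneg _) (Real.abs_sinc_le_one x)
  have h2 : Real.sinc x ^ 2 * x ^ 2 ≤ 1 := by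
    rcases eq_or_ne x 0 with rfl | hx
    · simp
    · rw [Real.sinc_of_ne_zero hx, div_pow, div_mul_cancel₀ _ (pow_ne_zero 2 hx)]
      exact Real.sin_sq_le_one x
  linarith

theorem integrable_sinc_pow {m : ℕ} (hm : 2 ≤ m) : Integrable fun x => Real.sinc x ^ m := by
  refine (integrable_inv_one_add_sq.const_mul 2).mono'
    (Real.continuous_sinc.pow m).aestronglyMeasurable (ae_of_all _ fun x => ?_)
  refine le_trans ?_ (sinc_sq_le x)
  rw [norm_pow, ← sq_abs (Real.sinc x)]
  exact pow_le_pow_of_le_one (abs_nonneg _) (Real.abs_sinc_le_one x) hm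

theorem hasImproperIntegral_sinc_pow {m : ℕ} (hm : 2 ≤ m) :
    HasImproperIntegral (fun x => Real.sinc x ^ m) (∫ x, Real.sinc x ^ m) :=
  intervalIntegral_tendsto_integral (integrable_sinc_pow hm) tendsto_fst tendsto_snd

end Dirichlet

/-! ### Balanced step sequences and the limit of their normalized number. -/

section DirichletKernel

/-- The Dirichlet kernel `∑ exp (i d θ)`, summed over `|d| ≤ b`. -/
noncomputable def dirichletKernel (b : ℕ) (θ : ℝ) : ℂ :=
  ∑ t ∈ Finset.range (2 * b + 1), Complex.exp (((t : ℂ) - b) * θ * Complex.I)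

@[fun_prop]
theorem continuous_dirichletKernel (b : ℕ) : Continuous (dirichletKernel b) := by
  unfold dirichletKernel
  fun_prop

/-- Multiplying by `sin v` turns each exponential into a difference of neighbouring half-steps, and
the sum telescopes. -/
theorem dirichletKernel_mul_sin (b : ℕ) (v : ℝ) :
    dirichletKernel b (2 * v) * Real.sin v = Real.sin ((2 * b + 1) * v) := by
  have h := Finset.sum_range_sub
    (fun t : ℕ => Complex.exp ((2 * ((t : ℂ) - b) - 1) * v * Complex.I)) (2 * b + 1)
  have h2 : ∀ t : ℕ, Complex.exp (((t : ℂ) - b) * (2 * v : ℝ) * Complex.I) * Complex.sin v =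
      (-Complex.I / 2) * (Complex.exp ((2 * (((t + 1 : ℕ) : ℂ) - b) - 1) * v * Complex.I) -
        Complex.exp ((2 * ((t : ℂ) - b) - 1) * v * Complex.I)) := by
    intro t
    rw [Complex.sin]
    have e1 : ((2 * (((t + 1 : ℕ) : ℂ) - b) - 1) * v * Complex.I) =
        ((t : ℂ) - b) * (2 * v : ℝ) * Complex.I + v * Complex.I := by push_cast; ring
    have e2 : ((2 * ((t : ℂ) - b) - 1) * v * Complex.I) =
        ((t : ℂ) - b) * (2 * v : ℝ) * Complex.I + -v * Complex.I := by push_cast; ring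
    rw [e1, e2, Complex.exp_add, Complex.exp_add]
    ring
  rw [dirichletKernel, Complex.ofReal_sin, Finset.sum_mul, Finset.sum_congr rfl fun t _ => h2 t,
    ← Finset.mul_sum, h, Complex.ofReal_sin, Complex.sin]
  have e1 : ((2 * (((2 * b + 1 : ℕ) : ℂ) - b) - 1) * v * Complex.I) =
      (((2 * b + 1) * v : ℝ) : ℂ) * Complex.I := by push_cast; ring
  have e2 : ((2 * (((0 : ℕ) : ℂ) - b) - 1) * v * Complex.I) =
      -(((2 * b + 1) * v : ℝ) : ℂ) * Complex.I := by push_cast; ring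
  rw [e1, e2]
  ring

/-- In the variable `u` the normalized kernel is `sinc u / sinc (u / l)` with `l = 2b + 1`, hence
tends to `sinc u`. The product form needs no case distinction at zeros of the denominator. -/
theorem dirichletKernel_mul_sinc (b : ℕ) (u : ℝ) :
    dirichletKernel b (2 * u / (2 * b + 1)) / (2 * b + 1) * Real.sinc (u / (2 * b + 1)) =
      Real.sinc u := by
  have hl : (2 * (b : ℝ) + 1) ≠ 0 := by positivity
  have hl' : (2 * (b : ℂ) + 1) ≠ 0 := by exact_mod_cast hl
  rcases eq_or_ne u 0 with rfl | hu
  · simp [dirichletKernel, hl']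
  · have h := dirichletKernel_mul_sin b (u / (2 * b + 1))
    rw [mul_div_cancel₀ _ hl, ← mul_div_assoc] at h
    rw [Real.sinc_of_ne_zero hu, Real.sinc_of_ne_zero (div_ne_zero hu hl), Complex.ofReal_div,
      Complex.ofReal_div, Complex.ofReal_div, ← h]
    have hu' : (u : ℂ) ≠ 0 := by exact_mod_cast hu
    push_cast
    field_simp

/-- The number of sequences of `m` steps in `{-b, …, b}` with sum `0`, the steps being shifted
by `b`. -/
noncomputable def balancedSteps (m b : ℕ) [NeZero m] : Finset (ZMod m → ℕ) :=
  (Fintype.piFinset fun _ => Finset.range (2 * b + 1)).filter fun t => ∑ k, t k = m * b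

theorem integral_exp_int_mul (n : ℤ) :
    ∫ θ in -Real.pi..Real.pi, Complex.exp ((n : ℂ) * θ * Complex.I) =
      if n = 0 then 2 * (Real.pi : ℂ) else 0 := by
  split_ifs with h
  · subst h
    simp
    ring
  · have hc : (n : ℂ) * Complex.I ≠ 0 := mul_ne_zero (by exact_mod_cast h) Complex.I_ne_zero
    have := integral_exp_mul_complex (a := -Real.pi) (b := Real.pi) hc
    simp_rw [mul_right_comm _ _ Complex.I]
    rw [this, div_eq_zero_iff]
    left
    rw [sub_eq_zero, Complex.exp_eq_exp_iff_exists_int]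
    exact ⟨n, by push_cast; ring⟩

theorem integral_dirichletKernel_pow (m b : ℕ) [NeZero m] :
    ∫ θ in -Real.pi..Real.pi, dirichletKernel b θ ^ m =
      2 * Real.pi * (balancedSteps m b).card := by
  have h : ∀ θ : ℝ, dirichletKernel b θ ^ m =
      ∑ t ∈ Fintype.piFinset fun _ : ZMod m => Finset.range (2 * b + 1),
        Complex.exp ((((∑ k, t k : ℕ) : ℤ) - ((m * b : ℕ) : ℤ) : ℤ) * θ * Complex.I) := by
    intro θ
    have : dirichletKernel b θ ^ m = ∏ _k : ZMod m, dirichletKernel b θ := by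
      rw [Finset.prod_const, Finset.card_univ, ZMod.card]
    rw [this]
    unfold dirichletKernel
    rw [Finset.prod_univ_sum]
    refine Finset.sum_congr rfl fun t _ => ?_
    rw [← Complex.exp_sum, ← Finset.sum_mul, ← Finset.sum_mul]
    congr 3
    push_cast
    rw [Finset.sum_sub_distrib, Finset.sum_const, Finset.card_univ, ZMod.card, nsmul_eq_mul]
  simp_rw [h]
  rw [intervalIntegral.integral_finsetSum]
  · simp_rw [integral_exp_int_mul, sub_eq_zero, Nat.cast_inj]
    rw [balancedSteps, ← Finset.sum_filter, Finset.sum_const, nsmul_eq_mul, mul_comm]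
  · intro t _
    exact Continuous.intervalIntegrable (by fun_prop) _ _

/-- Orthogonality of the exponentials on `[-π, π]`, followed by the substitution `θ = 2u / (2b +
1)`. -/
theorem balancedSteps_card_div_eq (m b : ℕ) [NeZero m] :
    ((balancedSteps m b).card : ℂ) / (2 * b + 1) ^ (m - 1) = 1 / Real.pi *
      ∫ u in -(Real.pi / 2 * (2 * b + 1))..(Real.pi / 2 * (2 * b + 1)),
        (dirichletKernel b (2 * u / (2 * b + 1)) / (2 * b + 1)) ^ m := by
  have hl : (2 * (b : ℝ) + 1) ≠ 0 := by positivity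
  have hl' : (2 * (b : ℂ) + 1) ≠ 0 := by exact_mod_cast hl
  have hpi : (Real.pi : ℂ) ≠ 0 := by exact_mod_cast Real.pi_ne_zero
  have h := intervalIntegral.integral_comp_mul_left
    (a := -(Real.pi / 2 * (2 * b + 1))) (b := Real.pi / 2 * (2 * b + 1))
    (c := 2 / (2 * (b : ℝ) + 1)) (fun θ => dirichletKernel b θ ^ m) (by positivity)
  have e1 : 2 / (2 * (b : ℝ) + 1) * -(Real.pi / 2 * (2 * b + 1)) = -Real.pi := by field_simp
  have e2 : 2 / (2 * (b : ℝ) + 1) * (Real.pi / 2 * (2 * b + 1)) = Real.pi := by field_simp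
  rw [e1, e2, integral_dirichletKernel_pow] at h
  simp_rw [div_pow]
  rw [intervalIntegral.integral_div]
  have e3 : ∀ u : ℝ, 2 / (2 * (b : ℝ) + 1) * u = 2 * u / (2 * b + 1) := fun u => by ring
  simp_rw [e3] at h
  rw [h, Complex.real_smul]
  obtain ⟨n, rfl⟩ : ∃ n, m = n + 1 := ⟨m - 1, (Nat.succ_pred_eq_of_ne_zero (NeZero.ne m)).symm⟩
  push_cast
  rw [pow_succ]
  field_simp

theorem tendsto_balancedSteps_complex {m : ℕ} [NeZero m] (hm : 2 ≤ m) :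
    Tendsto (fun b : ℕ => ((balancedSteps m b).card : ℂ) / (2 * b + 1) ^ (m - 1)) atTop
      (𝓝 (1 / Real.pi * (∫ u, Real.sinc u ^ m : ℝ))) := by
  simp_rw [balancedSteps_card_div_eq]
  refine Tendsto.const_mul _ ?_
  have hl : Tendsto (fun b : ℕ => 2 * (b : ℝ) + 1) atTop atTop :=
    tendsto_atTop_add_const_right _ _
      ((tendsto_natCast_atTop_atTop (R := ℝ)).const_mul_atTop (by norm_num))
  have hsinc : ∀ u : ℝ, Tendsto (fun b : ℕ => Real.sinc (u / (2 * b + 1))) atTop (𝓝 1) := by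
    intro u
    have h1 : Tendsto (fun b : ℕ => u / (2 * (b : ℝ) + 1)) atTop (𝓝 0) :=
      tendsto_const_nhds.div_atTop hl
    have := (Real.continuous_sinc.tendsto 0).comp h1
    rwa [Real.sinc_zero] at this
  -- Jordan's inequality `sin x ≥ 2x / π` on `[0, π / 2]`. It bounds the normalized kernel by `(π /
  -- 2) |sinc u|` on the whole range of integration, which gives the dominating function.
  have hlow : ∀ (b : ℕ) (u : ℝ), |u| ≤ Real.pi / 2 * (2 * b + 1) →
      2 / Real.pi ≤ Real.sinc (u / (2 * b + 1)) := by
    intro b u hu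
    have hl0 : 0 < 2 * (b : ℝ) + 1 := by positivity
    rw [← div_le_iff₀ hl0] at hu
    have habs : Real.sinc (u / (2 * b + 1)) = Real.sinc (|u| / (2 * b + 1)) := by
      rcases abs_cases u with h | h
      · rw [h.1]
      · rw [h.1, neg_div, Real.sinc_neg]
    rw [habs]
    rcases eq_or_ne u 0 with rfl | hu0
    · simp only [abs_zero, zero_div, Real.sinc_zero]
      rw [div_le_one Real.pi_pos]
      linarith [Real.pi_gt_three]
    · have hpos : 0 < |u| / (2 * b + 1) := by positivity
      rw [Real.sinc_of_ne_zero hpos.ne', le_div_iff₀ hpos]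
      exact Real.mul_le_sin hpos.le hu
  have hI : ∀ b : ℕ, ∫ u in -(Real.pi / 2 * (2 * b + 1))..(Real.pi / 2 * (2 * b + 1)),
        (dirichletKernel b (2 * u / (2 * b + 1)) / (2 * b + 1)) ^ m =
      ∫ u, (Set.Ioc (-(Real.pi / 2 * (2 * b + 1))) (Real.pi / 2 * (2 * b + 1))).indicator
        (fun u => (dirichletKernel b (2 * u / (2 * b + 1)) / (2 * b + 1)) ^ m) u := by
    intro b
    rw [intervalIntegral.integral_of_le, integral_indicator measurableSet_Ioc]
    have : 0 ≤ Real.pi / 2 * (2 * b + 1) := by positivity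
    linarith
  simp_rw [hI]
  rw [← integral_complex_ofReal]
  refine tendsto_integral_of_dominated_convergence
    (fun u => (Real.pi / 2) ^ m * ‖Real.sinc u ^ m‖) ?_
    ((integrable_sinc_pow hm).norm.const_mul _) ?_ ?_
  · intro b
    refine AEStronglyMeasurable.indicator ?_ measurableSet_Ioc
    exact Continuous.aestronglyMeasurable (by fun_prop)
  · intro b
    refine ae_of_all _ fun u => ?_
    by_cases hu : u ∈ Set.Ioc (-(Real.pi / 2 * (2 * b + 1))) (Real.pi / 2 * (2 * b + 1))
    · rw [Set.indicator_of_mem hu, norm_pow, norm_pow, ← mul_pow]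
      refine pow_le_pow_left₀ (norm_nonneg _) ?_ m
      have h1 := hlow b u (abs_le.2 ⟨hu.1.le, hu.2⟩)
      have h2 := congrArg norm (dirichletKernel_mul_sinc b u)
      have h3 : 0 < 2 / Real.pi := by positivity
      rw [norm_mul, Complex.norm_real, Complex.norm_real, Real.norm_of_nonneg (h3.le.trans h1)] at h2
      rw [← h2]
      calc _ = Real.pi / 2 * (‖dirichletKernel b (2 * u / (2 * b + 1)) / (2 * b + 1)‖ *
            (2 / Real.pi)) := by field_simp
        _ ≤ _ := by gcongr
    · rw [Set.indicator_of_notMem hu, norm_zero]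
      positivity
  · refine ae_of_all _ fun u => ?_
    have hev : ∀ᶠ b : ℕ in atTop, |u| + 1 ≤ Real.pi / 2 * (2 * (b : ℝ) + 1) :=
      (hl.const_mul_atTop (by positivity)).eventually_ge_atTop _
    have h1 : Tendsto (fun b : ℕ => ((Real.sinc u : ℂ) / (Real.sinc (u / (2 * b + 1)) : ℂ)) ^ m)
        atTop (𝓝 (((Real.sinc u : ℂ) / ((1 : ℝ) : ℂ)) ^ m)) := by
      refine Tendsto.pow (Tendsto.div tendsto_const_nhds ?_ (by simp)) m
      exact (Complex.continuous_ofReal.tendsto 1).comp (hsinc u)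
    simp only [Complex.ofReal_one, div_one] at h1
    rw [Complex.ofReal_pow]
    refine h1.congr' ?_
    filter_upwards [hev] with b hb
    have hu : u ∈ Set.Ioc (-(Real.pi / 2 * (2 * b + 1))) (Real.pi / 2 * (2 * b + 1)) := by
      have := abs_le.1 (show |u| ≤ Real.pi / 2 * (2 * (b : ℝ) + 1) - 1 by linarith)
      exact ⟨by linarith [this.1], by linarith [this.2]⟩
    rw [Set.indicator_of_mem hu, ← dirichletKernel_mul_sinc b u, mul_div_cancel_right₀]
    have h2 := hlow b u (by linarith)
    have h3 : 0 < 2 / Real.pi := by positivity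
    exact_mod_cast (h3.trans_le h2).ne'

/-- For `m ≥ 2` dominated convergence applies. For `m = 1` sinc is not absolutely integrable, but
the only balanced sequence is the zero step, so the count is `1` and the Dirichlet integral gives `J
= π`. -/
theorem exists_improperIntegral_sinc_pow (m : ℕ) [NeZero m] :
    ∃ J : ℝ, HasImproperIntegral (fun x => Real.sinc x ^ m) J ∧
      Tendsto (fun b : ℕ => ((balancedSteps m b).card : ℝ) / (2 * b + 1) ^ (m - 1)) atTop
        (𝓝 (1 / Real.pi * J)) := by
  rcases Nat.lt_or_ge m 2 with hm | hm
  · obtain rfl : m = 1 := by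
      have := NeZero.ne m
      omega
    refine ⟨Real.pi, by simpa using hasImproperIntegral_sinc, ?_⟩
    have h : ∀ b : ℕ, (balancedSteps 1 b).card = 1 := by
      intro b
      rw [Finset.card_eq_one]
      refine ⟨fun _ => b, ?_⟩
      ext t
      simp only [balancedSteps, Finset.mem_filter, Fintype.mem_piFinset, Finset.mem_range,
        Finset.mem_singleton, one_mul]
      constructor
      · rintro ⟨_, h⟩
        funext k
        rw [Fintype.sum_subsingleton _ k] at h
        exact h
      · rintro rfl
        exact ⟨fun _ => by change b < 2 * b + 1; omega, Fintype.sum_subsingleton _ 0⟩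
    simp [h, Real.pi_ne_zero]
  · refine ⟨_, hasImproperIntegral_sinc_pow hm, ?_⟩
    have h := (Complex.continuous_re.tendsto _).comp (tendsto_balancedSteps_complex hm)
    have e1 : ((1 / Real.pi : ℂ) * ((∫ u, Real.sinc u ^ m : ℝ) : ℂ)).re =
        1 / Real.pi * ∫ u, Real.sinc u ^ m := by
      rw [← Complex.ofReal_one, ← Complex.ofReal_div, ← Complex.ofReal_mul, Complex.ofReal_re]
    rw [e1] at h
    refine h.congr fun b => ?_
    simp only [Function.comp]
    have : ((balancedSteps m b).card : ℂ) / (2 * b + 1) ^ (m - 1) =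
        ((((balancedSteps m b).card : ℝ) / (2 * b + 1) ^ (m - 1) : ℝ) : ℂ) := by push_cast; rfl
    rw [this, Complex.ofReal_re]

end DirichletKernel

/-! ### Closed walks in the band graph and balanced step sequences. -/

section BandWalks

/-- The step from `i` to `j` on the cycle, shifted by `b`. -/
def shiftedStep {n : ℕ} (b : ℕ) (i j : Fin (n + 1)) : ZMod (n + 1) :=
  (show ZMod (n + 1) from j) - (show ZMod (n + 1) from i) + b

theorem val_shiftedStep {n : ℕ} (b : ℕ) (i j : Fin (n + 1)) :
    (shiftedStep b i j).val = ((j : ℕ) + (n + 1 - i) + b) % (n + 1) := by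
  rw [← ZMod.val_natCast]
  congr 1
  have hi : (((i : ℕ) : ZMod (n + 1))) = (show ZMod (n + 1) from i) :=
    ZMod.natCast_zmod_val (n := n + 1) i
  have hj : (((j : ℕ) : ZMod (n + 1))) = (show ZMod (n + 1) from j) :=
    ZMod.natCast_zmod_val (n := n + 1) j
  unfold shiftedStep
  rw [Nat.cast_add, Nat.cast_add, Nat.cast_sub i.is_lt.le, ZMod.natCast_self, hi, hj, zero_sub,
    ← sub_eq_add_neg]

/-- Shifting by `b` moves the steps `-b, …, b` to the residues `0, …, 2b`, which are distinct modulo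
`n + 1` because `2b + 1 ≤ n + 1`. -/
theorem cyclicDist_le_iff {n b : ℕ} (hb : 2 * b + 1 ≤ n + 1) (i j : Fin (n + 1)) :
    cyclicDist i j ≤ b ↔ (shiftedStep b i j).val < 2 * b + 1 := by
  rw [val_shiftedStep, cyclicDist]
  have hi := i.is_lt
  have hj := j.is_lt
  generalize (i : ℕ) = p at *
  generalize (j : ℕ) = q at *
  rcases Nat.lt_or_ge (q + (n + 1 - p) + b) (n + 1) with h | h
  · rw [Nat.mod_eq_of_lt h]
    omega
  · rw [Nat.mod_eq_sub_mod h]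
    rcases Nat.lt_or_ge (q + (n + 1 - p) + b - (n + 1)) (n + 1) with h' | h'
    · rw [Nat.mod_eq_of_lt h']
      omega
    · rw [Nat.mod_eq_sub_mod h', Nat.mod_eq_of_lt (by omega)]
      omega

open Classical in
theorem card_band_neighbours_le {n b : ℕ} (hb : 2 * b + 1 ≤ n + 1) (u : Fin (n + 1)) :
    (Finset.univ.filter fun v => cyclicDist u v ≤ b).card ≤ 2 * b + 1 := by
  have h : (Finset.univ.filter fun v => cyclicDist u v ≤ b).card ≤
      (Finset.range (2 * b + 1)).card := by
    refine Finset.card_le_card_of_injOn (fun v => (shiftedStep b u v).val) ?_ ?_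
    · intro v hv
      simp only [Finset.coe_filter, Finset.mem_univ, true_and, Set.mem_ofPred_eq,
        cyclicDist_le_iff hb] at hv
      simpa using hv
    · intro v _ w _ h
      have := ZMod.val_injective _ h
      simp only [shiftedStep, add_left_inj] at this
      exact sub_left_injective this
  simpa using h

theorem ZMod.sum_range_natCast {m : ℕ} [NeZero m] {M : Type*} [AddCommMonoid M] (f : ZMod m → M) :
    ∑ j ∈ Finset.range m, f (j : ZMod m) = ∑ k, f k := by
  refine Finset.sum_bij' (fun j _ => (j : ZMod m)) (fun k _ => k.val) (by simp)
    (fun k _ => Finset.mem_range.2 (ZMod.val_lt k)) (fun j hj => ?_) (by simp) (by simp)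
  exact ZMod.val_cast_of_lt (Finset.mem_range.1 hj)

theorem exists_walk_with_steps {m : ℕ} [NeZero m] {G : Type*} [AddCommGroup G] (v : G)
    (s : ZMod m → G) (hs : ∑ k, s k = 0) :
    ∃ x : ZMod m → G, x 0 = v ∧ ∀ k, x (k + 1) - x k = s k := by
  refine ⟨fun k => v + ∑ j ∈ Finset.range k.val, s j, by simp, fun k => ?_⟩
  have hk : s k = s ((k.val : ℕ) : ZMod m) := by rw [ZMod.natCast_zmod_val]
  by_cases h : k.val + 1 < m
  · have h1 : (k + 1).val = k.val + 1 := by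
      rw [ZMod.val_add, ZMod.val_one_eq_one_mod, Nat.add_mod_mod, Nat.mod_eq_of_lt h]
    simp only [h1]
    rw [Finset.sum_range_succ, ← hk]
    abel
  -- The last step returns to position `0`; this is where the total of the steps has to vanish.
  · have h2 : k.val + 1 = m := by
      have := ZMod.val_lt k
      omega
    have h1 : (k + 1).val = 0 := by
      rw [ZMod.val_add, ZMod.val_one_eq_one_mod, Nat.add_mod_mod, h2, Nat.mod_self]
    have h3 := ZMod.sum_range_natCast s
    have h4 : ∑ j ∈ Finset.range (k.val + 1), s j = 0 := by
      rw [← hs, ← h3]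
      exact Finset.sum_congr (by rw [h2]) fun _ _ => rfl
    rw [Finset.sum_range_succ, ← hk] at h4
    simp only [h1]
    rw [Finset.sum_range_zero, add_zero, sub_add_cancel_left, neg_eq_iff_add_eq_zero, h4]

theorem sum_steps_eq_zero {m : ℕ} [NeZero m] {G : Type*} [AddCommGroup G] (x : ZMod m → G) :
    ∑ k, (x (k + 1) - x k) = 0 := by
  rw [Finset.sum_sub_distrib, sub_eq_zero]
  exact Fintype.sum_equiv (Equiv.addRight 1) _ _ fun _ => rfl

theorem eq_of_steps_eq {m : ℕ} [NeZero m] {G : Type*} [AddCommGroup G] {x y : ZMod m → G}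
    (h0 : x 0 = y 0) (h : ∀ k, x (k + 1) - x k = y (k + 1) - y k) : x = y := by
  have key : ∀ n : ℕ, x n = y n := by
    intro n
    induction n with
    | zero => simpa using h0
    | succ n ih =>
      have := h n
      rw [ih] at this
      simpa using this
  funext k
  simpa using key k.val

/-- A walk is determined by its starting point and its steps. Closing up is a condition modulo `n +
1`; the bound `m * b < n + 1` excludes winding and makes it an equality of integers. -/
theorem card_closedWalks_band {m n b : ℕ} [NeZero m] (hb : 2 * b + 1 ≤ n + 1) (hm : m * b < n + 1) :
    (closedWalks m fun i j : Fin (n + 1) => cyclicDist i j ≤ b).card =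
      (n + 1) * (balancedSteps m b).card := by
  have hcard : ((Finset.univ : Finset (Fin (n + 1))) ×ˢ balancedSteps m b).card =
      (n + 1) * (balancedSteps m b).card := by
    rw [Finset.card_product, Finset.card_univ, Fintype.card_fin]
  rw [← hcard]
  refine Finset.card_bij (fun x _ => (x 0, fun k => (shiftedStep b (x k) (x (k + 1))).val)) ?_ ?_ ?_
  · intro x hx
    rw [mem_closedWalks] at hx
    have hlt : ∀ k, (shiftedStep b (x k) (x (k + 1))).val < 2 * b + 1 := fun k =>
      (cyclicDist_le_iff hb _ _).1 (hx k)
    rw [Finset.mem_product, balancedSteps, Finset.mem_filter, Fintype.mem_piFinset]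
    refine ⟨Finset.mem_univ _, fun k => Finset.mem_range.2 (hlt k), ?_⟩
    have h1 : ((∑ k, (shiftedStep b (x k) (x (k + 1))).val : ℕ) : ZMod (n + 1)) =
        ((m * b : ℕ) : ZMod (n + 1)) := by
      rw [Nat.cast_sum]
      simp_rw [ZMod.natCast_zmod_val, shiftedStep]
      rw [Finset.sum_add_distrib, sum_steps_eq_zero (G := ZMod (n + 1)) x]
      simp [ZMod.card]
    have h2 : ∑ k, (shiftedStep b (x k) (x (k + 1))).val ≤ 2 * (m * b) := by
      refine (Finset.sum_le_card_nsmul _ _ (2 * b) fun k _ => Nat.lt_succ_iff.1 (hlt k)).trans ?_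
      rw [Finset.card_univ, ZMod.card, smul_eq_mul]
      exact le_of_eq (by ring)
    rw [ZMod.natCast_eq_natCast_iff'] at h1
    rw [Nat.mod_eq_of_lt hm] at h1
    -- `S` is congruent to `m * b` modulo `n + 1` and lies in `[0, 2 * m * b]`. As `m * b < n + 1`,
    -- the only possibility is `S = m * b`.
    generalize ∑ k, (shiftedStep b (x k) (x (k + 1))).val = S at *
    rcases Nat.lt_or_ge S (n + 1) with h | h
    · rwa [Nat.mod_eq_of_lt h] at h1
    · rw [Nat.mod_eq_sub_mod h, Nat.mod_eq_of_lt (by omega)] at h1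
      omega
  · intro x _ y _ h
    simp only [Prod.mk.injEq] at h
    refine eq_of_steps_eq (G := ZMod (n + 1)) h.1 fun k => ?_
    have := ZMod.val_injective _ (congrFun h.2 k)
    simpa only [shiftedStep, add_left_inj] using this
  · rintro ⟨v, t⟩ ht
    rw [Finset.mem_product, balancedSteps, Finset.mem_filter, Fintype.mem_piFinset] at ht
    obtain ⟨_, ht1, ht2⟩ := ht
    simp only [Finset.mem_range] at ht1 ht2
    obtain ⟨x, hx0, hx⟩ := exists_walk_with_steps (G := ZMod (n + 1)) v
      (fun k => (t k : ZMod (n + 1)) - b) (by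
        rw [Finset.sum_sub_distrib, ← Nat.cast_sum, ht2]
        simp [ZMod.card])
    have hstep : ∀ k, (shiftedStep b (x k) (x (k + 1))).val = t k := by
      intro k
      have h1 : shiftedStep b (x k) (x (k + 1)) = (t k : ZMod (n + 1)) := by
        have := hx k
        change x (k + 1) - x k + (b : ZMod (n + 1)) = _
        rw [this, sub_add_cancel]
      rw [h1]
      exact ZMod.val_cast_of_lt ((ht1 k).trans_le hb)
    refine ⟨x, ?_, ?_⟩
    · refine mem_closedWalks.2 fun k => (cyclicDist_le_iff hb _ _).2 ?_
      rw [hstep]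
      exact ht1 k
    · exact Prod.ext hx0 (funext hstep)

end BandWalks

/-! ### Entries of a matrix product as sums over paths. -/

section Trace

theorem Matrix.list_prod_apply_eq_sum {ι R : Type*} [Fintype ι] [DecidableEq ι] [CommSemiring R] :
    ∀ (n : ℕ) (M : Fin n → Matrix ι ι R) (i j : ι), (List.ofFn M).prod i j =
      ∑ x : Fin (n + 1) → ι, if x 0 = i ∧ x (Fin.last n) = j then
        ∏ k : Fin n, M k (x k.castSucc) (x k.succ) else 0 := by
  intro n
  induction n with
  | zero =>
    intro M i j
    rw [← (Equiv.funUnique (Fin 1) ι).symm.sum_comp]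
    by_cases h : i = j
    · subst h
      simp [Equiv.funUnique]
    · have : ∀ x : ι, ¬ (x = i ∧ x = j) := fun x hx => h (hx.1.symm.trans hx.2)
      simp [Matrix.one_apply_ne h, this]
  | succ n ih =>
    intro M i j
    rw [List.ofFn_succ, List.prod_cons, Matrix.mul_apply,
      ← (Fin.consEquiv fun _ : Fin (n + 2) => ι).sum_comp, Fintype.sum_prod_type]
    simp_rw [ih, Finset.mul_sum]
    rw [Finset.sum_comm]
    rw [Finset.sum_comm (γ := ι)]
    refine Finset.sum_congr rfl fun x _ => ?_
    rw [Finset.sum_eq_single (x 0), Finset.sum_eq_single i]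
    · simp only [Fin.consEquiv_apply, Fin.cons_zero, true_and]
      rw [← Fin.succ_last, Fin.cons_succ]
      split_ifs
      · rw [Fin.prod_univ_succ]
        simp
      · simp
    · intro y _ hy
      simp [Fin.consEquiv, hy]
    · simp
    · intro y _ hy
      simp [Ne.symm hy]
    · simp

end Trace

/-! ### Distance of the characteristic functions and its limit. -/

section Approximation

theorem gradSq_C_mul {E : Type*} [Fintype E] (c : ℂ) (F : MvPolynomial E ℂ) (z : E → ℂ) :
    gradSq (MvPolynomial.C c * F) z = ‖c‖ ^ 2 * gradSq F z := by
  unfold gradSq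
  rw [Finset.mul_sum]
  refine Finset.sum_congr rfl fun e _ => ?_
  rw [MvPolynomial.pderiv_C_mul, map_mul, MvPolynomial.eval_C, norm_mul, mul_pow]

/-- Stein's bound applied to `conj t * F`, whose real part is the inner product of `F` and `t`; its
target variance is `‖t‖ ^ 2 * v`. -/
theorem norm_charFun_map_eval_sub_le {E : Type*} [Fintype E] {F : MvPolynomial E ℂ} {m : ℕ}
    (hm : m ≠ 0) (hF : F.IsHomogeneous m) (v : ℝ≥0) (t : ℂ) :
    ‖charFun ((gaussianFamily E).map fun z => MvPolynomial.eval z F) t -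
      charFun (complexGaussian v) t‖ ≤
      ‖t‖ ^ 2 / 2 * ∫ z, |gradSq F z / m - v| ∂gaussianFamily E := by
  have h := norm_integral_expRe_sub_le hm
    (F := MvPolynomial.C ((starRingEnd ℂ) t) * F) (by
      simpa using (MvPolynomial.isHomogeneous_C E ((starRingEnd ℂ) t)).mul hF)
    (v := ‖t‖ ^ 2 * v) (by positivity)
  have e1 : charFun ((gaussianFamily E).map fun z => MvPolynomial.eval z F) t =
      ∫ z, expRe (MvPolynomial.eval z (MvPolynomial.C ((starRingEnd ℂ) t) * F))
        ∂gaussianFamily E := by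
    rw [charFun_apply, integral_map (by fun_prop) (by fun_prop)]
    congr with z
    rw [expRe, map_mul, MvPolynomial.eval_C]
    congr 3
    simp [Complex.inner]
  have e2 : ∫ z, |gradSq (MvPolynomial.C ((starRingEnd ℂ) t) * F) z / m - ‖t‖ ^ 2 * v|
      ∂gaussianFamily E = ‖t‖ ^ 2 * ∫ z, |gradSq F z / m - v| ∂gaussianFamily E := by
    rw [← integral_const_mul]
    congr with z
    rw [gradSq_C_mul, RCLike.norm_conj, mul_div_assoc, ← mul_sub, abs_mul,
      abs_of_nonneg (by positivity : 0 ≤ ‖t‖ ^ 2)]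
  rw [e1, charFun_complexGaussian, mul_comm (v : ℝ)]
  rw [e2] at h
  linarith

theorem integral_abs_gradSq_div_sub_le {E : Type*} [Fintype E] (F : MvPolynomial E ℂ) {m : ℕ}
    (hm : m ≠ 0) (v : ℝ) :
    ∫ z, |gradSq F z / m - v| ∂gaussianFamily E ≤
      (∫ z, |gradSq F z - ∫ w, gradSq F w ∂gaussianFamily E| ∂gaussianFamily E) +
        |(∫ w, gradSq F w ∂gaussianFamily E) / m - v| := by
  set μ := ∫ w, gradSq F w ∂gaussianFamily E
  have hi := integrable_gradSq F
  have hm1 : (1 : ℝ) ≤ m := by exact_mod_cast Nat.one_le_iff_ne_zero.2 hm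
  have hadd := integral_add (μ := gaussianFamily E) (f := fun z => |gradSq F z - μ|)
    (g := fun _ => |μ / m - v|) (hi.sub (integrable_const μ)).abs (integrable_const _)
  rw [integral_const, probReal_univ, one_smul] at hadd
  rw [← hadd]
  refine integral_mono ((hi.div_const _).sub (integrable_const v)).abs
    ((hi.sub (integrable_const μ)).abs.add (integrable_const _)) fun z => ?_
  have e : gradSq F z / m - v = (gradSq F z - μ) / m + (μ / m - v) := by ring
  simp only [e]
  refine (abs_add_le _ _).trans (add_le_add ?_ le_rfl)
  rw [abs_div, abs_of_nonneg (by positivity : (0 : ℝ) ≤ m)]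
  exact div_le_self (abs_nonneg _) hm1

/-- The bound for the distance of the normalized squared gradient to its limit. -/
noncomputable def gradError (m p : ℕ) [NeZero m] (v : ℝ) (N b : ℕ) : ℝ :=
  √(varianceConst m / N) + (m * p + meanConst m) * m ^ 2 / (2 * b + 1) +
    |p * ((balancedSteps m b).card / (2 * b + 1) ^ (m - 1)) - v|

/-- The normalization of the trace of a word of length `m`. -/
noncomputable def traceScale (m N b : ℕ) : ℝ :=
  √((bandLength N b : ℝ) / N) * (1 / √(bandLength N b : ℝ)) ^ m

theorem traceScale_sq (m N b : ℕ) :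
    traceScale m N b ^ 2 = bandLength N b / N / (bandLength N b : ℝ) ^ m := by
  rw [traceScale, mul_pow, Real.sq_sqrt (by positivity), ← pow_mul, mul_comm m 2, pow_mul,
    div_pow, Real.sq_sqrt (by positivity), one_pow, one_div, inv_pow, div_eq_mul_inv _ (_ ^ m)]

/-- The three terms of `gradError` are the fluctuation of the squared gradient, the contribution of
non-injective walks to its mean, and the distance of the normalized walk count from its limit. -/
theorem integral_gradSq_le_gradError {m N b p R : ℕ} [NeZero m] (hN : 2 * b + 1 ≤ N)
    (hm : m * b < N) (a : ZMod m → Fin R)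
    (hp : (Finset.univ.filter fun k : ZMod m => ∀ j, a (j + k) = a j).card = p) (v : ℝ) :
    ∫ z, |gradSq (walkPoly a (fun i j : Fin N => cyclicDist i j ≤ b) (traceScale m N b)) z / m - v|
      ∂gaussianFamily (Fin R × Fin N × Fin N) ≤ gradError m p v N b := by
  classical
  have hm0 : m ≠ 0 := NeZero.ne m
  obtain ⟨n, rfl⟩ : ∃ n, N = n + 1 := ⟨N - 1, by omega⟩
  set F := walkPoly a (fun i j : Fin (n + 1) => cyclicDist i j ≤ b) (traceScale m (n + 1) b)
  have hl : ∀ u : Fin (n + 1), (@Finset.filter _ (fun v => cyclicDist u v ≤ b)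
      (fun _ => Classical.propDecidable _) Finset.univ).card ≤ 2 * b + 1 := fun u => by
    convert card_band_neighbours_le hN u
  have hc : traceScale m (n + 1) b ^ 2 =
      (2 * b + 1) / (n + 1 : ℕ) / (2 * (b : ℝ) + 1) ^ m := by
    rw [traceScale_sq, bandLength, min_eq_left hN]
    push_cast
    rfl
  obtain ⟨k, rfl⟩ : ∃ k, m = k + 1 := ⟨m - 1, by omega⟩
  have hn0 : (((n + 1 : ℕ) : ℝ)) ≠ 0 := by positivity
  have hl0 : (2 * (b : ℝ) + 1) ≠ 0 := by positivity
  have h1 := gradSq_walkPoly_concentration (A := fun i j => cyclicDist i j ≤ b) a hl (traceScale (k + 1) (n + 1) b)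
  have h2 := abs_integral_gradSq_walkPoly_sub_le (A := fun i j => cyclicDist i j ≤ b) a hl
    (traceScale (k + 1) (n + 1) b) (p := p) (by convert hp)
  rw [Fintype.card_fin] at h1 h2
  rw [card_closedWalks_band hN hm] at h2
  refine (integral_abs_gradSq_div_sub_le F hm0 v).trans ?_
  -- With `c² = l / (N l ^ m)`, the number of meeting pairs times `c⁴` is exactly `1 / N`.
  have e1 : traceScale (k + 1) (n + 1) b ^ 4 * (((n + 1 : ℕ) : ℝ) *
      (((2 * b + 1 : ℕ) : ℝ) ^ (k + 1 - 1) * ((2 * b + 1 : ℕ) : ℝ) ^ (k + 1 - 1))) =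
      1 / (n + 1 : ℕ) := by
    rw [show traceScale (k + 1) (n + 1) b ^ 4 = (traceScale (k + 1) (n + 1) b ^ 2) ^ 2 by ring, hc,
      Nat.add_sub_cancel, pow_succ]
    push_cast at hn0 ⊢
    field_simp
    ring
  rw [e1, mul_one_div] at h1
  have h3 := Real.le_sqrt_of_sq_le h1
  set μ := ∫ w, gradSq F w ∂gaussianFamily (Fin R × Fin (n + 1) × Fin (n + 1))
  have e2 : traceScale (k + 1) (n + 1) b ^ 2 * (((k + 1 : ℕ) : ℝ) * p *
      (((n + 1) * (balancedSteps (k + 1) b).card : ℕ) : ℝ)) =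
      ((k + 1 : ℕ) : ℝ) * (p * ((balancedSteps (k + 1) b).card / (2 * b + 1) ^ (k + 1 - 1))) := by
    rw [hc, Nat.add_sub_cancel, pow_succ]
    push_cast at hn0 ⊢
    field_simp
  have hM : 0 ≤ meanConst (k + 1) := by
    have := one_le_momentBound (k + 1)
    unfold meanConst
    positivity
  have e3 : traceScale (k + 1) (n + 1) b ^ 2 * ((((k + 1 : ℕ) : ℝ) * p + meanConst (k + 1)) *
      ((((k + 1) * (k + 1) - (k + 1) : ℕ) : ℝ) *
        (((n + 1 : ℕ) : ℝ) * ((2 * b + 1 : ℕ) : ℝ) ^ (k + 1 - 2)))) ≤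
      (((k + 1 : ℕ) : ℝ) * p + meanConst (k + 1)) * ((k + 1 : ℕ) : ℝ) ^ 2 / (2 * b + 1) := by
    -- For `m = 1` the exponent `m - 2` is truncated to `0`, but the factor `m * m - m` is zero, so
    -- the bound still holds.
    rcases Nat.eq_zero_or_pos k with rfl | hk
    · simp only [zero_add, mul_one, Nat.sub_self, Nat.cast_zero, zero_mul, mul_zero]
      positivity
    · obtain ⟨q, rfl⟩ : ∃ q, k = q + 1 := ⟨k - 1, by omega⟩
      have h4 : ((((q + 1 + 1) * (q + 1 + 1) - (q + 1 + 1) : ℕ) : ℝ)) ≤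
          ((q + 1 + 1 : ℕ) : ℝ) ^ 2 := by
        rw [← Nat.cast_pow, sq]
        exact_mod_cast Nat.sub_le _ _
      have h5 : traceScale (q + 1 + 1) (n + 1) b ^ 2 *
          (((n + 1 : ℕ) : ℝ) * ((2 * b + 1 : ℕ) : ℝ) ^ (q + 1 + 1 - 2)) = 1 / (2 * b + 1) := by
        rw [hc, show q + 1 + 1 - 2 = q by omega, pow_succ, pow_succ]
        push_cast at hn0 ⊢
        field_simp
      calc _ = (((q + 1 + 1 : ℕ) : ℝ) * p + meanConst (q + 1 + 1)) *
            (((q + 1 + 1) * (q + 1 + 1) - (q + 1 + 1) : ℕ) : ℝ) *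
            (traceScale (q + 1 + 1) (n + 1) b ^ 2 *
              (((n + 1 : ℕ) : ℝ) * ((2 * b + 1 : ℕ) : ℝ) ^ (q + 1 + 1 - 2))) := by ring
        _ ≤ (((q + 1 + 1 : ℕ) : ℝ) * p + meanConst (q + 1 + 1)) * ((q + 1 + 1 : ℕ) : ℝ) ^ 2 *
            (1 / (2 * b + 1)) := by
          rw [h5]
          gcongr
        _ = _ := by ring
  rw [e2] at h2
  have h6 := h2.trans e3
  set y := (p : ℝ) * ((balancedSteps (k + 1) b).card / (2 * b + 1) ^ (k + 1 - 1)) with hy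
  have hk1 : (1 : ℝ) ≤ ((k + 1 : ℕ) : ℝ) := by exact_mod_cast Nat.succ_le_succ (Nat.zero_le k)
  have h7 : |μ / ((k + 1 : ℕ) : ℝ) - v| ≤ |μ - ((k + 1 : ℕ) : ℝ) * y| + |y - v| := by
    have e : μ / ((k + 1 : ℕ) : ℝ) - v = (μ - ((k + 1 : ℕ) : ℝ) * y) / ((k + 1 : ℕ) : ℝ) +
        (y - v) := by
      field_simp
      ring
    rw [e]
    refine (abs_add_le _ _).trans (add_le_add ?_ le_rfl)
    rw [abs_div, abs_of_nonneg (by positivity : (0 : ℝ) ≤ ((k + 1 : ℕ) : ℝ))]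
    exact div_le_self (abs_nonneg _) hk1
  unfold gradError
  rw [← hy]
  linarith

theorem tendsto_gradError {m p : ℕ} [NeZero m] {J : ℝ}
    (hJ : Tendsto (fun b : ℕ => ((balancedSteps m b).card : ℝ) / (2 * b + 1) ^ (m - 1)) atTop
      (𝓝 (1 / Real.pi * J))) {b : ℕ → ℕ} (hb : Tendsto b atTop atTop) :
    Tendsto (fun N => gradError m p (p * (1 / Real.pi * J)) N (b N)) atTop (𝓝 0) := by
  have h1 : Tendsto (fun N : ℕ => √(varianceConst m / N)) atTop (𝓝 0) := by
    have := (tendsto_const_div_atTop_nhds_zero_nat (varianceConst m)).sqrt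
    rwa [Real.sqrt_zero] at this
  have h2 : Tendsto (fun N : ℕ => (m * p + meanConst m) * m ^ 2 / (2 * (b N : ℝ) + 1)) atTop
      (𝓝 0) := by
    refine tendsto_const_nhds.div_atTop (tendsto_atTop_add_const_right _ _ ?_)
    exact ((tendsto_natCast_atTop_atTop (R := ℝ)).comp hb).const_mul_atTop (by norm_num)
  have h3 : Tendsto (fun N : ℕ => |(p : ℝ) * ((balancedSteps m (b N)).card /
      (2 * (b N : ℝ) + 1) ^ (m - 1)) - p * (1 / Real.pi * J)|) atTop (𝓝 0) := by
    have := (((hJ.comp hb).const_mul (p : ℝ)).sub_const (p * (1 / Real.pi * J))).abs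
    rwa [sub_self, abs_zero] at this
  have := (h1.add h2).add h3
  rw [add_zero, add_zero] at this
  exact this

end Approximation

/-! ### The trace as a walk polynomial, and the conclusion. -/

section Main

/-- A path with equal endpoints loses its last vertex; since addition in `Fin (n + 1)` wraps around,
the last factor returns to `x 0`. -/
theorem Matrix.trace_list_prod_eq_sum {ι R : Type*} [Fintype ι] [DecidableEq ι] [CommSemiring R]
    (n : ℕ) (M : Fin (n + 1) → Matrix ι ι R) :
    (List.ofFn M).prod.trace = ∑ x : Fin (n + 1) → ι, ∏ k, M k (x k) (x (k + 1)) := by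
  simp only [Matrix.trace, Matrix.diag_apply, Matrix.list_prod_apply_eq_sum]
  rw [Finset.sum_comm, ← (Fin.snocEquiv fun _ : Fin (n + 2) => ι).sum_comp,
    Fintype.sum_prod_type_right]
  refine Finset.sum_congr rfl fun x _ => ?_
  rw [Finset.sum_eq_single (x 0), Finset.sum_eq_single (x 0)]
  · have h0 : Fin.snoc (α := fun _ => ι) x (x 0) 0 = x 0 :=
      Fin.snoc_castSucc (α := fun _ => ι) (x 0) x 0
    simp only [Fin.snocEquiv_apply, Fin.snoc_last, h0, and_self, if_true]
    refine Finset.prod_congr rfl fun k _ => ?_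
    congr 1
    · exact Fin.snoc_castSucc (α := fun _ => ι) (x 0) x k
    · rcases Fin.eq_castSucc_or_eq_last k with ⟨j, rfl⟩ | rfl
      · rw [Fin.succ_castSucc, Fin.coeSucc_eq_succ]
        exact Fin.snoc_castSucc (α := fun _ => ι) (x 0) x j.succ
      · rw [Fin.succ_last, Fin.last_add_one]
        exact Fin.snoc_last (α := fun _ => ι) (x 0) x
  · intro i _ hi
    have h0 : Fin.snoc (α := fun _ => ι) x (x 0) 0 = x 0 :=
      Fin.snoc_castSucc (α := fun _ => ι) (x 0) x 0
    simp [Fin.snocEquiv, h0, Ne.symm hi]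
  · simp
  · intro v _ hv
    refine Finset.sum_eq_zero fun i _ => ?_
    have h0 : Fin.snoc (α := fun _ => ι) x v 0 = x 0 :=
      Fin.snoc_castSucc (α := fun _ => ι) v x 0
    rw [if_neg]
    simp only [Fin.snocEquiv_apply, Fin.snoc_last, h0]
    rintro ⟨rfl, h⟩
    exact hv h
  · simp

theorem scaled_trace_wordMatrix_eq {w : FreeMonoid ℕ} {n N b R : ℕ} {a : ZMod (n + 1) → Fin R}
    (hw : w.toList = List.ofFn fun k : Fin (n + 1) => (a k : ℕ)) (Z : ℕ → Fin N → Fin N → ℂ) :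
    ((√((bandLength N b : ℝ) / (N : ℝ)) : ℝ) : ℂ) *
      (wordMatrix (fun r => bandMatrix b (Z r)) w).trace =
    MvPolynomial.eval (fun e : Fin R × Fin N × Fin N => Z e.1 e.2.1 e.2.2)
      (walkPoly a (fun i j : Fin N => cyclicDist i j ≤ b) (traceScale (n + 1) N b)) := by
  classical
  have h1 : wordMatrix (fun r => bandMatrix b (Z r)) w =
      (List.ofFn fun k : Fin (n + 1) => bandMatrix b (Z (a k))).prod := by
    rw [wordMatrix, FreeMonoid.lift_apply, hw, List.map_ofFn]
    rfl
  have h2 : ∀ x : Fin (n + 1) → Fin N,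
      ∏ k : Fin (n + 1), bandMatrix b (Z (a k)) (x k) (x (k + 1)) =
      if x ∈ closedWalks (n + 1) (fun i j : Fin N => cyclicDist i j ≤ b) then
        ((1 / √(bandLength N b : ℝ) : ℝ) : ℂ) ^ (n + 1) *
          ∏ k : Fin (n + 1), Z (a k) (x k) (x (k + 1)) else 0 := by
    intro x
    split_ifs with hx
    · have hx' : ∀ k : Fin (n + 1), cyclicDist (x k) (x (k + 1)) ≤ b := mem_closedWalks.1 hx
      simp only [bandMatrix, Matrix.of_apply, hx', if_true]
      rw [Finset.prod_mul_distrib, Finset.prod_const, Finset.card_univ, Fintype.card_fin]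
    · obtain ⟨k, hk⟩ : ∃ k : Fin (n + 1), ¬ cyclicDist (x k) (x (k + 1)) ≤ b := by
        by_contra! h
        exact hx (mem_closedWalks.2 h)
      refine Finset.prod_eq_zero (Finset.mem_univ k) ?_
      simp [bandMatrix, hk]
  rw [h1, Matrix.trace_list_prod_eq_sum, eval_walkPoly, Finset.sum_congr rfl fun x _ => h2 x,
    ← Finset.sum_filter, ← Finset.mul_sum, ← mul_assoc, traceScale]
  push_cast
  congr 1
  refine Finset.sum_congr ?_ fun x _ => rfl
  ext x
  simp only [Finset.mem_filter, Finset.mem_univ, true_and]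
  exact Iff.rfl

theorem tendsto_atTop_of_div_rpow {b : ℕ → ℕ}
    (hb : Tendsto (fun N : ℕ => (b N : ℝ) / (N : ℝ) ^ (1 / 3 : ℝ)) atTop atTop) :
    Tendsto b atTop atTop := by
  rw [← tendsto_natCast_atTop_iff (R := ℝ)]
  refine tendsto_atTop_mono' _ ?_ hb
  filter_upwards [eventually_ge_atTop 1] with N hN
  have : (1 : ℝ) ≤ (N : ℝ) ^ (1 / 3 : ℝ) :=
    Real.one_le_rpow (by exact_mod_cast hN) (by norm_num)
  exact div_le_self (Nat.cast_nonneg _) this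

theorem eventually_band_small {b : ℕ → ℕ} (m : ℕ)
    (hb : Tendsto (fun N : ℕ => (b N : ℝ) / (N : ℝ)) atTop (𝓝 0)) :
    ∀ᶠ N in atTop, 2 * b N + 1 ≤ N ∧ m * b N < N := by
  -- The threshold yields `b N * (m + 2) < N`, which implies both inequalities.
  have h : (0 : ℝ) < 1 / (m + 2) := by positivity
  filter_upwards [hb.eventually_lt_const h, eventually_gt_atTop 0] with N hN hN0
  have hN0' : (0 : ℝ) < N := by exact_mod_cast hN0
  rw [div_lt_div_iff₀ hN0' (by positivity), one_mul] at hN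
  have h1 : b N * (m + 2) < N := by exact_mod_cast hN
  constructor <;> nlinarith [Nat.zero_le (b N), Nat.zero_le m, Nat.zero_le (b N * m)]

theorem map_restrict_eq_gaussianFamily {Ω : Type*} [MeasurableSpace Ω] {P : Measure Ω}
    [IsProbabilityMeasure P] {N : ℕ} {Z : ℕ → Fin N → Fin N → Ω → ℂ}
    (hlaw : ∀ r i j, HasLaw (Z r i j) (complexGaussian 1) P)
    (hindep : iIndepFun (fun p : ℕ × Fin N × Fin N => Z p.1 p.2.1 p.2.2) P) (R : ℕ) :
    P.map (fun ω (e : Fin R × Fin N × Fin N) => Z e.1 e.2.1 e.2.2 ω) =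
      gaussianFamily (Fin R × Fin N × Fin N) := by
  have hinj : Function.Injective
      (fun e : Fin R × Fin N × Fin N => ((e.1 : ℕ), e.2)) := by
    rintro ⟨r, p⟩ ⟨s, q⟩ h
    simp only [Prod.mk.injEq] at h
    exact Prod.ext (Fin.ext h.1) h.2
  have h := hindep.precomp hinj
  rw [iIndepFun_iff_map_fun_eq_pi_map fun e => (hlaw _ _ _).aemeasurable] at h
  rw [h]
  congr 1
  funext e
  exact (hlaw _ _ _).map_eq

theorem mainTheorem12
    -- a nonempty word in the letters `G_0, G_1, …`, without conjugate transposes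
    (w : FreeMonoid ℕ) (hw : w ≠ 1)
    -- a band parameter with `N ^ (1/3) ≪ b N ≪ N`
    (b : ℕ → ℕ)
    (hb₁ : Tendsto (fun N : ℕ => (b N : ℝ) / (N : ℝ) ^ (1 / 3 : ℝ)) atTop atTop)
    (hb₂ : Tendsto (fun N : ℕ => (b N : ℝ) / (N : ℝ)) atTop (𝓝 0))
    -- for each `N`, i.i.d. standard complex Gaussian variables `Z N r i j`
    {Ω : ℕ → Type*} [∀ N, MeasurableSpace (Ω N)]
    (P : ∀ N, Measure (Ω N)) [∀ N, IsProbabilityMeasure (P N)]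
    (Z : ∀ N, ℕ → Fin N → Fin N → Ω N → ℂ)
    (hlaw : ∀ N r i j, HasLaw (Z N r i j) (complexGaussian 1) (P N))
    (hindep : ∀ N, iIndepFun (fun p : ℕ × Fin N × Fin N => Z N p.1 p.2.1 p.2.2) (P N)) :
    ∃ (J : ℝ) (α : ℝ≥0),
      HasImproperIntegral (fun θ : ℝ => Real.sinc θ ^ w.length) J ∧
      (α : ℝ) = 1 / Real.pi * J ∧
      TendstoInDistribution
        (fun (N : ℕ) (ω : Ω N) =>
          ((√((bandLength N (b N) : ℝ) / (N : ℝ)) : ℝ) : ℂ) *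
            (wordMatrix (fun r => bandMatrix (b N) (fun i j => Z N r i j ω)) w).trace)
        atTop id P (complexGaussian ((coperiod w : ℝ≥0) * α)) := by
  classical
  obtain ⟨n, hn⟩ : ∃ n, w.length = n + 1 :=
    Nat.exists_eq_succ_of_ne_zero fun h => hw (FreeMonoid.length_eq_zero.1 h)
  obtain ⟨J, hJ, hlim⟩ := exists_improperIntegral_sinc_pow (n + 1)
  -- Nonnegativity of `α_m` comes from the counting: it is a limit of normalized cardinalities.
  have hJ0 : 0 ≤ 1 / Real.pi * J := ge_of_tendsto' hlim fun b => by positivity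
  refine ⟨J, ⟨1 / Real.pi * J, hJ0⟩, by rw [hn]; exact hJ, rfl, ?_⟩
  -- Only finitely many letters occur in `w`, so for each `N` a finite Gaussian family suffices.
  obtain ⟨R, hR⟩ : ∃ R, ∀ r ∈ w.toList, r < R :=
    ⟨w.toList.sum + 1, fun r hr => Nat.lt_succ_of_le (List.le_sum_of_mem hr)⟩
  have hlen : w.toList.length = n + 1 := hn
  let a : ZMod (n + 1) → Fin R := fun k =>
    ⟨w.toList[(show Fin (n + 1) from k).val]'(by rw [hlen]; exact (show Fin (n + 1) from k).is_lt),
      hR _ (List.getElem_mem _)⟩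
  have hwa : w.toList = List.ofFn fun k : Fin (n + 1) => (a k : ℕ) := by
    refine List.ext_getElem (by simp [hlen]) fun i h1 h2 => ?_
    rw [List.getElem_ofFn]
  have hcop : (Finset.univ.filter fun k : ZMod (n + 1) => ∀ j, a (j + k) = a j).card =
      coperiod w := by
    rw [coperiod_eq_card_periods hn (a := fun k => (a k : ℕ))]
    · simp only [Fin.ext_iff]
    · intro i
      exact List.getElem?_eq_getElem _
  have hT : ∀ N (ω : Ω N), ((√((bandLength N (b N) : ℝ) / (N : ℝ)) : ℝ) : ℂ) *
      (wordMatrix (fun r => bandMatrix (b N) (fun i j => Z N r i j ω)) w).trace =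
      MvPolynomial.eval (fun e : Fin R × Fin N × Fin N => Z N e.1 e.2.1 e.2.2 ω)
        (walkPoly a (fun i j : Fin N => cyclicDist i j ≤ b N) (traceScale (n + 1) N (b N))) :=
    fun N ω => scaled_trace_wordMatrix_eq hwa fun r i j => Z N r i j ω
  have hζ : ∀ N, AEMeasurable
      (fun ω (e : Fin R × Fin N × Fin N) => Z N e.1 e.2.1 e.2.2 ω) (P N) :=
    fun N => aemeasurable_pi_lambda _ fun e => (hlaw N _ _ _).aemeasurable
  have hmeas : ∀ N, AEMeasurable (fun ω : Ω N =>
      ((√((bandLength N (b N) : ℝ) / (N : ℝ)) : ℝ) : ℂ) *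
      (wordMatrix (fun r => bandMatrix (b N) (fun i j => Z N r i j ω)) w).trace) (P N) := by
    intro N
    simp_rw [hT]
    exact (continuous_eval_mvPolynomial _).measurable.comp_aemeasurable (hζ N)
  refine ⟨hmeas, aemeasurable_id, ?_⟩
  refine ProbabilityMeasure.tendsto_of_tendsto_charFun fun t => ?_
  simp only [ProbabilityMeasure.coe_mk, Measure.map_id]
  have hmap : ∀ N, (P N).map (fun ω : Ω N =>
      ((√((bandLength N (b N) : ℝ) / (N : ℝ)) : ℝ) : ℂ) *
      (wordMatrix (fun r => bandMatrix (b N) (fun i j => Z N r i j ω)) w).trace) =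
      (gaussianFamily (Fin R × Fin N × Fin N)).map fun z => MvPolynomial.eval z
        (walkPoly a (fun i j : Fin N => cyclicDist i j ≤ b N) (traceScale (n + 1) N (b N))) := by
    intro N
    simp_rw [hT]
    rw [← map_restrict_eq_gaussianFamily (hlaw N) (hindep N) R,
      AEMeasurable.map_map_of_aemeasurable (by fun_prop) (hζ N)]
    rfl
  simp_rw [hmap]
  rw [tendsto_iff_norm_sub_tendsto_zero]
  have herr := (tendsto_gradError (p := coperiod w) hlim (tendsto_atTop_of_div_rpow hb₁)).const_mul
    (‖t‖ ^ 2 / 2)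
  rw [mul_zero] at herr
  refine squeeze_zero' (Eventually.of_forall fun N => norm_nonneg _) ?_ herr
  filter_upwards [eventually_band_small (n + 1) hb₂] with N hN
  refine (norm_charFun_map_eval_sub_le (Nat.succ_ne_zero n) (isHomogeneous_walkPoly _ _ _) _ t).trans
    (mul_le_mul_of_nonneg_left ?_ (by positivity))
  exact integral_gradSq_le_gradError hN.1 hN.2 a hcop _

end Main
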